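/- Let $G$ be a finite-dimensional real Lie group with identity $e$ and Lie algebra $\mathfrak g=T_eG$, let $\mathcal L_g:G\to G$ be the left translation by $g$, and let $L:TG\times\mathbb R\to\mathbb R$ be a smooth function (a contact Lagrangian). For $(g,\xi,z)\in G\times\mathfrak g\times\mathbb R$ write $\tilde L(g,\xi,z)=L(g,T_e\mathcal L_g\xi,z)$ for $L$ in the left-trivialized coordinates $(g,\dot g,z)\mapsto(g,T_g\mathcal L_{g^{-1}}\dot g,z)$. Let $\frac{\delta L}{\delta\xi}\in\mathfrak g^*$, $\frac{\delta L}{\delta g}\in T_g^*G$ and $\frac{\partial L}{\partial z}\in\mathbb R$ be the partial derivatives of $\tilde L$, let $T_e^*\mathcal L_g:T_g^*G\to\mathfrak g^*$ be the transpose of $T_e\mathcal L_g$, and let $\mathrm{ad}^*_\xi:\mathfrak g^*\to\mathfrak g^*$ be the transpose of $\mathrm{ad}_\xi=[\xi,\cdot\,]$. Let $h>0$, let $g:[0,h]\to G$ be a smooth curve, and let $\xi:[0,h]\to\mathfrak g$ and $z:[0,h]\to\mathbb R$ be functions. We say that $g$ is critical for the Herglotz action with initial value $z_0$ if, for every smooth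 variation $c(t,s)$ of $g$ with fixed endpoints (that is, $c$ is smooth on $[0,h]\times(-\varepsilon,\varepsilon)$ for some $\varepsilon>0$, $c(t,0)=g(t)$, $c(0,s)=g(0)$ and $c(h,s)=g(h)$), with $z(t,s)$ for $s$ near $0$ denoting the solution on $[0,h]$ of $$\frac{\partial z}{\partial t}=L\Big(c,\frac{\partial c}{\partial t},z\Big),\qquad z(0,s)=z_0,$$ one has $$\frac{d}{ds}\Big|_{s=0}\int_0^hL\Big(c(t,s),\frac{\partial c}{\partial t}(t,s),z(t,s)\Big)\,dt=0 .$$ Then the following are equivalent: 1. $\xi(t)=T_{g(t)}\mathcal L_{g(t)^{-1}}(\dot g(t))$ and $\dot z(t)=L(g(t),\dot g(t),z(t))$ for all $t\in[0,h]$, and $g$ is critical for the Herglotz action with initial value $z(0)$. 2. $(g,\xi,z)$ satisfies on $[0,h]$ the Herglotz equations on Lie groups $$\frac{d}{dt}\frac{\delta L}{\delta\xi}=\mathrm{ad}^*_\xi\frac{\delta L}{\delta\xi}+T_e^*\mathcal L_g\Big(\frac{\delta L}{\delta g}\Big)+\frac{\delta L}{\delta\xi}\frac{\partial L}{\partial z},\qquad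 \dot g=T_e\mathcal L_g(\xi),\qquad \dot z=L .$$ In particular, critical curves of the Herglotz action satisfy the Herglotz equations on Lie groups. -/

import Mathlib

open Set Filter Topology
open scoped Manifold ContDiff Bundle

noncomputable section

namespace Herglotz

variable {E : Type*} [NormedAddCommGroup E] [NormedSpace ℝ E]
  {G : Type*} [TopologicalSpace G] [ChartedSpace E G]

/-- The velocity, as a point of `TG`, at time `t` of a curve defined on the interval `[0, h]`
(one-sided at the two endpoints). -/
def velocity (h : ℝ) (γ : ℝ → G) (t : ℝ) : TangentBundle 𝓘(ℝ, E) G :=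
  ⟨γ t, mfderivWithin 𝓘(ℝ, ℝ) 𝓘(ℝ, E) γ (Icc 0 h) t (1 : ℝ)⟩

/-- The function `ζ` satisfies, along the curve `γ`, the initial value problem
`ζ' = L(γ, γ', ζ)` on `[0, h]`, `ζ(0) = z₀`. -/
def SolvesHerglotzODE (L : TangentBundle 𝓘(ℝ, E) G × ℝ → ℝ) (h z₀ : ℝ)
    (γ : ℝ → G) (ζ : ℝ → ℝ) : Prop :=
  ζ 0 = z₀ ∧
    ∀ t ∈ Icc (0 : ℝ) h, HasDerivWithinAt ζ (L (velocity h γ t, ζ t)) (Icc 0 h) t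

/-- The value `∫₀ʰ L(γ(t), γ'(t), ζ(t)) dt` of the Herglotz action at the curve `γ`; here `ζ` is
the function attached to `γ` by the initial value problem `SolvesHerglotzODE`. -/
def action (L : TangentBundle 𝓘(ℝ, E) G × ℝ → ℝ) (h : ℝ) (γ : ℝ → G) (ζ : ℝ → ℝ) : ℝ :=
  ∫ t in (0 : ℝ)..h, L (velocity h γ t, ζ t)

/-- A smooth variation with fixed endpoints of the curve `γ : [0, h] → G`: a map `c (t, s)`,
smooth on `[0, h] × (-ε, ε)` for some `ε > 0`. -/
structure IsVariation (h : ℝ) (γ : ℝ → G) (c : ℝ → ℝ → G) : Prop where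
  smooth : ∃ ε > 0, ContMDiffOn 𝓘(ℝ, ℝ × ℝ) 𝓘(ℝ, E) ∞ (fun p : ℝ × ℝ => c p.1 p.2)
    (Icc 0 h ×ˢ Ioo (-ε) ε)
  base : ∀ t ∈ Icc (0 : ℝ) h, c t 0 = γ t
  left : ∀ᶠ s in 𝓝 (0 : ℝ), c 0 s = γ 0
  right : ∀ᶠ s in 𝓝 (0 : ℝ), c h s = γ h

/-- The curve `γ` is critical for the Herglotz action with initial value `z₀`: along each
variation with fixed endpoints, the derivative of the action at `s = 0` exists and vanishes. The
function `Z s` is the solution of the initial value problem along the varied curve `c(·, s)`. -/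
def IsCritical (L : TangentBundle 𝓘(ℝ, E) G × ℝ → ℝ) (h z₀ : ℝ) (γ : ℝ → G) : Prop :=
  ∀ c : ℝ → ℝ → G, IsVariation (E := E) h γ c →
    ∀ Z : ℝ → ℝ → ℝ, (∀ᶠ s in 𝓝 (0 : ℝ), SolvesHerglotzODE L h z₀ (fun t => c t s) (Z s)) →
      HasDerivAt (fun s => action L h (fun t => c t s) (Z s)) 0 0

variable [Group G]

/-- `T_e 𝓛_g : 𝔤 → T_g G`, the derivative at the identity of the left translation by `g`. -/
def leftTangent (g : G) : GroupLieAlgebra 𝓘(ℝ, E) G →L[ℝ] TangentSpace 𝓘(ℝ, E) g :=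
  (mfderiv 𝓘(ℝ, E) 𝓘(ℝ, E) (fun x : G => g * x) 1 :)

/-- The `𝔤`-component `T_g 𝓛_{g⁻¹} (v)` of `v ∈ T_g G` in the left trivialization of `TG`. -/
def leftTrivialize (v : TangentBundle 𝓘(ℝ, E) G) : GroupLieAlgebra 𝓘(ℝ, E) G :=
  (mfderiv 𝓘(ℝ, E) 𝓘(ℝ, E) (fun x : G => v.proj⁻¹ * x) v.proj v.snd :)

/-- The Lagrangian in the left-trivialized coordinates: `(g, ξ, z) ↦ L(g, T_e 𝓛_g ξ, z)`. -/
def trivialized (L : TangentBundle 𝓘(ℝ, E) G × ℝ → ℝ)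
    (g : G) (ξ : GroupLieAlgebra 𝓘(ℝ, E) G) (z : ℝ) : ℝ :=
  L (⟨g, leftTangent g ξ⟩, z)

/-- The functional derivative `δL/δξ ∈ 𝔤*`. -/
def derivXi (L : TangentBundle 𝓘(ℝ, E) G × ℝ → ℝ)
    (g : G) (ξ : GroupLieAlgebra 𝓘(ℝ, E) G) (z : ℝ) : GroupLieAlgebra 𝓘(ℝ, E) G →L[ℝ] ℝ :=
  fderiv ℝ (fun ξ' => trivialized L g ξ' z) ξ

/-- The partial derivative `δL/δg ∈ T_g* G`, at fixed `ξ` and `z`. -/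
def derivG (L : TangentBundle 𝓘(ℝ, E) G × ℝ → ℝ)
    (g : G) (ξ : GroupLieAlgebra 𝓘(ℝ, E) G) (z : ℝ) : TangentSpace 𝓘(ℝ, E) g →L[ℝ] ℝ :=
  (mfderiv 𝓘(ℝ, E) 𝓘(ℝ, ℝ) (fun g' => trivialized L g' ξ z) g :)

/-- The partial derivative `∂L/∂z`. -/
def derivZ (L : TangentBundle 𝓘(ℝ, E) G × ℝ → ℝ)
    (g : G) (ξ : GroupLieAlgebra 𝓘(ℝ, E) G) (z : ℝ) : ℝ :=
  deriv (fun z' => trivialized L g ξ z') z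

/-- `T_e* 𝓛_g : T_g* G → 𝔤*`, the transpose of `T_e 𝓛_g`. -/
def leftCotangent (g : G) (α : TangentSpace 𝓘(ℝ, E) g →L[ℝ] ℝ) :
    GroupLieAlgebra 𝓘(ℝ, E) G →L[ℝ] ℝ :=
  α.comp (leftTangent g)

instance [FiniteDimensional ℝ E] : FiniteDimensional ℝ (GroupLieAlgebra 𝓘(ℝ, E) G) :=
  inferInstanceAs (FiniteDimensional ℝ E)

instance : T2Space (GroupLieAlgebra 𝓘(ℝ, E) G) :=
  inferInstanceAs (T2Space E)

instance [LieGroup 𝓘(ℝ, E) ∞ G] : LieGroup 𝓘(ℝ, E) (minSmoothness ℝ 3) G :=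
  LieGroup.of_le (n := ∞) (by simpa using (mod_cast le_top : ((3 : ℕ∞) : WithTop ℕ∞) ≤ ∞))

/-- `ad_ξ : 𝔤 → 𝔤`, `η ↦ [ξ, η]`. -/
def adjoint [FiniteDimensional ℝ E] [LieGroup 𝓘(ℝ, E) ∞ G] (ξ : GroupLieAlgebra 𝓘(ℝ, E) G) :
    GroupLieAlgebra 𝓘(ℝ, E) G →L[ℝ] GroupLieAlgebra 𝓘(ℝ, E) G :=
  haveI : CompleteSpace E := FiniteDimensional.complete ℝ E
  LinearMap.toContinuousLinearMap (LieAlgebra.ad ℝ (GroupLieAlgebra 𝓘(ℝ, E) G) ξ)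

/-- `ad_ξ* : 𝔤* → 𝔤*`, the transpose of `ad_ξ`. -/
def coad [FiniteDimensional ℝ E] [LieGroup 𝓘(ℝ, E) ∞ G] (ξ : GroupLieAlgebra 𝓘(ℝ, E) G)
    (μ : GroupLieAlgebra 𝓘(ℝ, E) G →L[ℝ] ℝ) : GroupLieAlgebra 𝓘(ℝ, E) G →L[ℝ] ℝ :=
  μ.comp (adjoint ξ)

end Herglotz

end

/-! Let `φ` be the chart at the identity and `p = φ(1)`. For small `s` every variation of `g` reads
`c(t, s) = g(t) φ⁻¹(u(t, s))` with `u(t, 0) = p`, and its velocity is the tangent map of `x ↦ g(t)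
φ⁻¹(x)` applied to `R(u) ξ + ∂ₜu`. Here `ξ` is the body velocity of `g` and `R(x)` is the
differential at the identity of right translation by `φ⁻¹(x)` (`velocity_chartTranslate`). The
problem thus moves to an open subset of the vector space `E`, with a time-dependent Lagrangian `ℓ(t,
x, v, z)` and the constant curve `p` as base curve.

Integrating the ODE for `z` turns the action into `z(h, s) - z₀`, so its derivative is the final
value of `ζ = ∂ₛz`. This `ζ` solves the linear equation `ζ' = force(η) + μ(η') + b ζ`, where `η =
∂ₛu`, `μ = ∂ℓ/∂v` and `b = ∂ℓ/∂z` (`hasDerivAt_final_value`, by Gronwall). With `defect = μ' - force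
- b μ`, the solution is `ζ = μ(η) - I`, where `I' = b I + defect(η)` and `I(0) = 0`. Since `η(h) =
0`, the first variation is `-e^{∫b} ∫ e^{-∫b} defect(η)`. The weight is positive and `η = a(t) v` is
realized for every bump function `a` and vector `v`, so criticality means `defect = 0`.

It remains to identify the defect with the intrinsic equation. The force differentiates `v` along `D
R`, whereas `δL/δg`, taken at fixed `ξ` in the left trivialization, differentiates it along the
differential of left translations. The two derivatives at `p` differ by the Lie bracket
(`bracket_eq_fderiv`), and this difference is the `ad*` term (`force_eq`). -/

noncomputable section

namespace Herglotz

/-! ### Dependence of scalar ODEs on a parameter -/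

section ParametrizedODE

/-- Compactness of `[0, h]` makes the continuity of `D` along the curve uniform: one radius `δ`
serves all times. -/
theorem exists_uniform_nhds_curve {F W : Type*} [NormedAddCommGroup F] [NormedAddCommGroup W]
    {V : Set F} (hV : IsOpen V) {h : ℝ} {y : ℝ → F} (hy : ContinuousOn y (Icc 0 h))
    (hyV : ∀ t ∈ Icc 0 h, y t ∈ V) {D : ℝ → F → W}
    (hD : ContinuousOn (Function.uncurry D) (Icc 0 h ×ˢ V)) {η : ℝ} (hη : 0 < η) :
    ∃ δ > 0, ∀ t ∈ Icc 0 h, ∀ w, ‖w - y t‖ < δ → w ∈ V ∧ ‖D t w - D t (y t)‖ ≤ η := by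
  -- The variable is the displacement `w` from the curve, so that all times share the base point
  -- `0`. The repeated hypothesis on `t` sits inside the predicate because continuity is known only
  -- within `[0, h]`, while the compactness argument asks for full neighbourhoods of `(0, t)`.
  have key : ∀ᶠ w : F in 𝓝 0, ∀ t ∈ Icc 0 h, t ∈ Icc 0 h → (y t + w ∈ V ∧
      ‖D t (y t + w) - D t (y t)‖ ≤ η) := by
    refine isCompact_Icc.eventually_forall_of_forall_eventually fun t ht => ?_
    have hcont : ContinuousWithinAt (fun q : F × ℝ => y q.2 + q.1) (univ ×ˢ Icc 0 h) (0, t) :=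
      (((hy t ht).comp continuousWithinAt_snd (fun q hq => hq.2)).add continuousWithinAt_fst)
    have hyc : ContinuousWithinAt (fun q : F × ℝ => y q.2) (univ ×ˢ Icc 0 h) (0, t) :=
      (hy t ht).comp continuousWithinAt_snd (fun q hq => hq.2)
    have hmem : ∀ᶠ q in 𝓝[univ ×ˢ Icc 0 h] ((0 : F), t), y q.2 + q.1 ∈ V :=
      hcont (hV.mem_nhds (by simpa using hyV t ht))
    have hD0 := hD (t, y t) ⟨ht, hyV t ht⟩
    have h1 : Tendsto (fun q : F × ℝ => Function.uncurry D (q.2, y q.2 + q.1))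
        (𝓝[univ ×ˢ Icc 0 h] (0, t)) (𝓝 (D t (y t))) := by
      refine Tendsto.comp hD0 (tendsto_nhdsWithin_iff.2 ⟨?_, ?_⟩)
      · have := (continuousWithinAt_snd (s := univ ×ˢ Icc 0 h) (p := ((0 : F), t))).prodMk hcont
        simpa [ContinuousWithinAt] using this
      · filter_upwards [hmem, self_mem_nhdsWithin] with q hq hq' using ⟨hq'.2, hq⟩
    have h2 : Tendsto (fun q : F × ℝ => Function.uncurry D (q.2, y q.2))
        (𝓝[univ ×ˢ Icc 0 h] (0, t)) (𝓝 (D t (y t))) := by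
      refine Tendsto.comp hD0 (tendsto_nhdsWithin_iff.2 ⟨?_, ?_⟩)
      · have := (continuousWithinAt_snd (s := univ ×ˢ Icc 0 h) (p := ((0 : F), t))).prodMk hyc
        simpa [ContinuousWithinAt] using this
      · filter_upwards [self_mem_nhdsWithin] with q hq' using ⟨hq'.2, hyV _ hq'.2⟩
    have h3 := (h1.sub h2).norm
    rw [sub_self, norm_zero] at h3
    have h4 := hmem.and (h3.eventually (gt_mem_nhds hη))
    rw [eventually_nhdsWithin_iff] at h4
    filter_upwards [h4] with q hq hq'
    exact ⟨(hq ⟨mem_univ _, hq'⟩).1, (hq ⟨mem_univ _, hq'⟩).2.le⟩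
  obtain ⟨δ, hδ, hball⟩ := Metric.eventually_nhds_iff.1 key
  refine ⟨δ, hδ, fun t ht w hw => ?_⟩
  have := hball (y := w - y t) (by simpa using hw) t ht ht
  simpa using this

/-- Uniform strict differentiability along a compact curve. -/
theorem exists_uniform_linearization {F : Type*} [NormedAddCommGroup F] [NormedSpace ℝ F]
    {V : Set F} (hV : IsOpen V) {h : ℝ} {y : ℝ → F} (hy : ContinuousOn y (Icc 0 h))
    (hyV : ∀ t ∈ Icc 0 h, y t ∈ V) {f : ℝ → F → ℝ} {D : ℝ → F → F →L[ℝ] ℝ}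
    (hf : ∀ t ∈ Icc 0 h, ∀ w ∈ V, HasFDerivAt (f t) (D t w) w)
    (hD : ContinuousOn (Function.uncurry D) (Icc 0 h ×ˢ V)) {η : ℝ} (hη : 0 < η) :
    ∃ δ > 0, ∀ t ∈ Icc 0 h, ∀ w₁ w₂, ‖w₁ - y t‖ < δ → ‖w₂ - y t‖ < δ →
      w₁ ∈ V ∧ |f t w₂ - f t w₁ - D t (y t) (w₂ - w₁)| ≤ η * ‖w₂ - w₁‖ := by
  obtain ⟨δ, hδ, H⟩ := exists_uniform_nhds_curve hV hy hyV hD hη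
  refine ⟨δ, hδ, fun t ht w₁ w₂ h₁ h₂ => ⟨(H t ht w₁ h₁).1, ?_⟩⟩
  have hb : ∀ w ∈ Metric.ball (y t) δ, w ∈ V ∧ ‖D t w - D t (y t)‖ ≤ η := fun w hw =>
    H t ht w (by simpa [dist_eq_norm] using hw)
  exact (convex_ball (y t) δ).norm_image_sub_le_of_norm_hasFDerivWithin_le'
    (fun w hw => (hf t ht w (hb w hw).1).hasFDerivWithinAt) (fun w hw => (hb w hw).2)
    (by simpa [dist_eq_norm] using h₁) (by simpa [dist_eq_norm] using h₂)

theorem abs_clamp_sub_clamp_le (r x y : ℝ) :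
    |max (-r) (min r x) - max (-r) (min r y)| ≤ |x - y| := by
  have h1 := abs_max_sub_max_le_abs (min r x) (min r y) (-r)
  have h2 := abs_min_sub_min_le_max r x r y
  rw [max_comm (-r), max_comm (-r)]
  refine h1.trans (h2.trans ?_)
  simp

theorem abs_clamp_le {r : ℝ} (hr : 0 ≤ r) (x : ℝ) : |max (-r) (min r x)| ≤ r := by
  rw [abs_le]
  exact ⟨le_max_left _ _, max_le (by linarith) (min_le_left _ _)⟩

theorem clamp_eq_self {r x : ℝ} (hx : |x| ≤ r) : max (-r) (min r x) = x := by
  rw [abs_le] at hx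
  rw [min_eq_right hx.2, max_eq_right hx.1]

theorem HasDerivWithinAt.Ici_of_Icc {F : Type*} [NormedAddCommGroup F] [NormedSpace ℝ F]
    {f : ℝ → F} {f' : F} {a b t : ℝ} (ht : t ∈ Ico a b)
    (hf : HasDerivWithinAt f f' (Icc a b) t) : HasDerivWithinAt f f' (Ici t) t :=
  hf.mono_of_mem_nhdsWithin (Icc_mem_nhdsGE_of_mem ht)

variable {h δ : ℝ} {f : ℝ → ℝ × ℝ → ℝ} {D : ℝ → ℝ × ℝ → ℝ × ℝ →L[ℝ] ℝ} {z : ℝ → ℝ}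

theorem gronwallBound_zero_mul (K ε c x : ℝ) :
    gronwallBound 0 K (ε * c) x = gronwallBound 0 K ε x * c := by
  unfold gronwallBound
  split_ifs <;> ring

/-- Solutions of a scalar ODE depending on a parameter persist, and stay close, when the
parameter varies. -/
theorem eventually_exists_solution (hh : 0 < h) (hδ : 0 < δ)
    (hfc : ContinuousOn (Function.uncurry f) (Icc 0 h ×ˢ (Ioo (-δ) δ ×ˢ univ)))
    (hf : ∀ t ∈ Icc 0 h, ∀ w ∈ Ioo (-δ) δ ×ˢ (univ : Set ℝ), HasFDerivAt (f t) (D t w) w)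
    (hD : ContinuousOn (Function.uncurry D) (Icc 0 h ×ˢ (Ioo (-δ) δ ×ˢ univ)))
    (hz : ∀ t ∈ Icc 0 h, HasDerivWithinAt z (f t (0, z t)) (Icc 0 h) t) :
    ∃ C, ∀ᶠ s in 𝓝 (0 : ℝ), ∃ Y : ℝ → ℝ, Y 0 = z 0 ∧
      (∀ t ∈ Icc 0 h, HasDerivWithinAt Y (f t (s, Y t)) (Icc 0 h) t) ∧
      ∀ t ∈ Icc 0 h, |Y t - z t| ≤ C * |s| := by
  have hzc : ContinuousOn z (Icc 0 h) := fun t ht => (hz t ht).continuousWithinAt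
  have hy : ContinuousOn (fun t => ((0 : ℝ), z t)) (Icc 0 h) := continuousOn_const.prodMk hzc
  have hV : IsOpen (Ioo (-δ) δ ×ˢ (univ : Set ℝ)) := isOpen_Ioo.prod isOpen_univ
  have hyV : ∀ t ∈ Icc 0 h, ((0 : ℝ), z t) ∈ Ioo (-δ) δ ×ˢ (univ : Set ℝ) :=
    fun t _ => ⟨⟨by simpa using hδ, hδ⟩, mem_univ _⟩
  obtain ⟨ρ, hρ, H⟩ := exists_uniform_linearization hV hy hyV hf hD one_pos
  have hDc : ContinuousOn (fun t => D t (0, z t)) (Icc 0 h) :=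
    hD.comp (continuousOn_id.prodMk hy) fun t ht => ⟨ht, hyV t ht⟩
  obtain ⟨K₀, hK₀⟩ := isCompact_Icc.exists_bound_of_continuousOn hDc
  have hK₀0 : 0 ≤ K₀ := (norm_nonneg _).trans (hK₀ 0 ⟨le_rfl, hh.le⟩)
  set K := K₀ + 1 with hK
  have hKpos : 0 ≤ K := by positivity
  have lip : ∀ t ∈ Icc 0 h, ∀ w₁ w₂, ‖w₁ - (0, z t)‖ < ρ → ‖w₂ - (0, z t)‖ < ρ →
      |f t w₂ - f t w₁| ≤ K * ‖w₂ - w₁‖ := by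
    intro t ht w₁ w₂ h₁ h₂
    have a := (H t ht w₁ w₂ h₁ h₂).2
    have b : |D t (0, z t) (w₂ - w₁)| ≤ K₀ * ‖w₂ - w₁‖ :=
      ((D t (0, z t)).le_opNorm _).trans (by gcongr; exact hK₀ t ht)
    calc |f t w₂ - f t w₁|
        = |(f t w₂ - f t w₁ - D t (0, z t) (w₂ - w₁)) + D t (0, z t) (w₂ - w₁)| := by ring_nf
      _ ≤ _ := abs_add_le _ _
      _ ≤ K * ‖w₂ - w₁‖ := by rw [hK]; linarith
  set r := ρ / 2 with hr
  have hrpos : 0 < r := by positivity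
  -- The difference of solutions satisfies `|(Y - z)'| ≤ K |Y - z| + K |s|` with zero initial value,
  -- so Gronwall bounds it by this constant times `|s|`.
  set C := gronwallBound 0 K K h with hC
  refine ⟨C, ?_⟩
  have hC0 : 0 ≤ C := by
    have := gronwallBound_mono (δ := 0) le_rfl hKpos hKpos hh.le
    rwa [gronwallBound_x0] at this
  have e1 : ∀ᶠ s in 𝓝 (0 : ℝ), |s| < r := by
    have : Tendsto (fun s : ℝ => |s|) (𝓝 0) (𝓝 0) := by
      simpa using (continuous_abs.tendsto (0 : ℝ))
    exact this.eventually (gt_mem_nhds hrpos)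
  have e2 : ∀ᶠ s in 𝓝 (0 : ℝ), C * |s| < r := by
    have : Tendsto (fun s : ℝ => C * |s|) (𝓝 0) (𝓝 0) := by
      simpa using (show Continuous fun s : ℝ => C * |s| by fun_prop).tendsto 0
    exact this.eventually (gt_mem_nhds hrpos)
  have e3 : ∀ᶠ s in 𝓝 (0 : ℝ), s ∈ Ioo (-δ) δ := Ioo_mem_nhds (by simpa using hδ) hδ
  filter_upwards [e1, e2, e3] with s hs1 hs2 hs3
  -- The right-hand side is truncated to a tube of radius `r` around `z`. The truncated field is
  -- bounded and globally Lipschitz, so Picard–Lindelöf solves it on all of `[0, h]`. Gronwall then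
  -- keeps the solution within `C |s| < r` of `z`, where the truncation is inactive.
  set cl : ℝ → ℝ := fun x => max (-r) (min r x) with hcl
  have hclc : Continuous cl := by fun_prop
  set g : ℝ → ℝ → ℝ := fun t x => f t (s, z t + cl (x - z t)) with hg
  have near : ∀ t x, ‖(s, z t + cl (x - z t)) - ((0 : ℝ), z t)‖ < ρ := by
    intro t x
    rw [Prod.norm_def]
    simp only [Prod.mk_sub_mk, sub_zero, add_sub_cancel_left, Real.norm_eq_abs]
    exact max_lt (by linarith) ((abs_clamp_le hrpos.le _).trans_lt (by linarith))
  have near0 : ∀ t, ‖((0 : ℝ), z t) - (0, z t)‖ < ρ := by simpa using hρ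
  have glip : ∀ t ∈ Icc 0 h, ∀ x y, |g t x - g t y| ≤ K * |x - y| := by
    intro t ht x y
    refine (lip t ht _ _ (near t y) (near t x)).trans ?_
    gcongr
    rw [Prod.norm_def]
    simp only [Prod.mk_sub_mk, sub_self, norm_zero, add_sub_add_left_eq_sub, Real.norm_eq_abs]
    refine max_le (abs_nonneg _) ((abs_clamp_sub_clamp_le r _ _).trans ?_)
    rw [sub_sub_sub_cancel_right]
  have gz : ∀ t ∈ Icc 0 h, ∀ x, |g t x - f t (0, z t)| ≤ K * (|s| + |x - z t|) := by
    intro t ht x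
    refine (lip t ht _ _ (near0 t) (near t x)).trans ?_
    gcongr
    rw [Prod.norm_def]
    simp only [Prod.mk_sub_mk, sub_zero, add_sub_cancel_left, Real.norm_eq_abs]
    refine max_le (by linarith [abs_nonneg (x - z t)]) ?_
    have := abs_clamp_sub_clamp_le r (x - z t) 0
    rw [clamp_eq_self (x := 0) (by simpa using hrpos.le)] at this
    simp only [sub_zero] at this
    exact this.trans (by linarith [abs_nonneg s])
  have gbd : ∀ t ∈ Icc 0 h, ∀ x, |g t x - f t (0, z t)| ≤ K * ρ := by
    intro t ht x
    exact (lip t ht _ _ (near0 t) (near t x)).trans (by gcongr; exact (near t x).le)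
  have hf0c : ContinuousOn (fun t => f t (0, z t)) (Icc 0 h) :=
    hfc.comp (continuousOn_id.prodMk hy) fun t ht => ⟨ht, hyV t ht⟩
  obtain ⟨B, hB⟩ := isCompact_Icc.exists_bound_of_continuousOn hf0c
  have hB0 : 0 ≤ B := (norm_nonneg _).trans (hB 0 ⟨le_rfl, hh.le⟩)
  have hpl : IsPicardLindelof g (⟨0, ⟨le_rfl, hh.le⟩⟩ : Icc (0 : ℝ) h) (z 0)
      (((B + K * ρ) * h).toNNReal) 0 ((B + K * ρ).toNNReal) K.toNNReal := by
    refine ⟨fun t ht => LipschitzOnWith.of_dist_le_mul fun x _ y _ => ?_, fun x _ => ?_,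
      fun t ht x _ => ?_, ?_⟩
    · simpa [Real.dist_eq, hKpos] using glip t ht x y
    · refine hfc.comp (continuousOn_id.prodMk (continuousOn_const.prodMk
        (hzc.add (hclc.comp_continuousOn (continuousOn_const.sub hzc))))) fun t ht => ?_
      exact ⟨ht, hs3, mem_univ _⟩
    · rw [Real.coe_toNNReal _ (by positivity), Real.norm_eq_abs]
      have h1 := gbd t ht x
      have h2 := hB t ht
      rw [Real.norm_eq_abs] at h2
      calc |g t x| = |(g t x - f t (0, z t)) + f t (0, z t)| := by ring_nf
        _ ≤ _ := abs_add_le _ _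
        _ ≤ _ := by linarith
    · rw [Real.coe_toNNReal _ (by positivity), Real.coe_toNNReal _ (by positivity)]
      simp [hh.le]
  obtain ⟨Y, hY0, hY⟩ := hpl.exists_eq_forall_mem_Icc_hasDerivWithinAt₀
  simp only at hY0
  have hgr : ∀ t ∈ Icc 0 h, ‖Y t - z t‖ ≤ gronwallBound 0 K (K * |s|) (t - 0) := by
    refine norm_le_gronwallBound_of_norm_deriv_right_le (f := fun t => Y t - z t)
      (f' := fun t => g t (Y t) - f t (0, z t)) (ContinuousOn.sub
        (fun t ht => (hY t ht).continuousWithinAt) hzc) (fun t ht => ?_) (by simp [hY0])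
      (fun t ht => ?_)
    · exact HasDerivWithinAt.Ici_of_Icc ht
        ((hY t (Ico_subset_Icc_self ht)).sub (hz t (Ico_subset_Icc_self ht)))
    · have := gz t (Ico_subset_Icc_self ht) (Y t)
      simp only [Real.norm_eq_abs]
      linarith
  have hYz : ∀ t ∈ Icc 0 h, |Y t - z t| ≤ C * |s| := by
    intro t ht
    refine (hgr t ht).trans ?_
    rw [sub_zero, gronwallBound_zero_mul]
    gcongr
    exact gronwallBound_mono le_rfl hKpos hKpos ht.2
  refine ⟨Y, hY0, fun t ht => ?_, hYz⟩
  have := hY t ht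
  simp only [hg, hcl] at this
  rwa [clamp_eq_self ((hYz t ht).trans hs2.le), add_sub_cancel] at this

/-- No global Lipschitz constant is available, but two given solutions stay in a common closed ball,
on which `F'` is bounded uniformly in time. -/
theorem eqOn_of_solves {F : ℝ → ℝ → ℝ} {F' : ℝ → ℝ → ℝ} {Y Z : ℝ → ℝ}
    (hF : ∀ t ∈ Icc 0 h, ∀ x, HasDerivAt (F t) (F' t x) x)
    (hF' : ContinuousOn (Function.uncurry F') (Icc 0 h ×ˢ univ))
    (hY : ∀ t ∈ Icc 0 h, HasDerivWithinAt Y (F t (Y t)) (Icc 0 h) t)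
    (hZ : ∀ t ∈ Icc 0 h, HasDerivWithinAt Z (F t (Z t)) (Icc 0 h) t) (h0 : Y 0 = Z 0) :
    EqOn Y Z (Icc 0 h) := by
  have hYc : ContinuousOn Y (Icc 0 h) := fun t ht => (hY t ht).continuousWithinAt
  have hZc : ContinuousOn Z (Icc 0 h) := fun t ht => (hZ t ht).continuousWithinAt
  obtain ⟨R₁, hR₁⟩ := isCompact_Icc.exists_bound_of_continuousOn hYc
  obtain ⟨R₂, hR₂⟩ := isCompact_Icc.exists_bound_of_continuousOn hZc
  set R := max R₁ R₂
  have hcomp : IsCompact (Icc 0 h ×ˢ Metric.closedBall (0 : ℝ) R) :=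
    isCompact_Icc.prod (isCompact_closedBall _ _)
  obtain ⟨K, hK⟩ := hcomp.exists_bound_of_continuousOn
    (hF'.mono (prod_mono_right (subset_univ _)))
  refine ODE_solution_unique_of_mem_Icc_right (v := F) (K := K.toNNReal)
    (s := fun _ => Metric.closedBall 0 R) (fun t ht => ?_) hYc
    (fun t ht => HasDerivWithinAt.Ici_of_Icc ht (hY t (Ico_subset_Icc_self ht)))
    (fun t ht => ?_) hZc
    (fun t ht => HasDerivWithinAt.Ici_of_Icc ht (hZ t (Ico_subset_Icc_self ht)))
    (fun t ht => ?_) h0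
  · refine (convex_closedBall (0 : ℝ) R).lipschitzOnWith_of_nnnorm_hasDerivWithin_le
      (fun x _ => (hF t (Ico_subset_Icc_self ht) x).hasDerivWithinAt) fun x hx => ?_
    have := hK (t, x) ⟨Ico_subset_Icc_self ht, hx⟩
    rw [← NNReal.coe_le_coe, coe_nnnorm]
    exact this.trans (Real.le_coe_toNNReal _)
  · exact mem_closedBall_zero_iff.2 ((hR₁ t (Ico_subset_Icc_self ht)).trans (le_max_left _ _))
  · exact mem_closedBall_zero_iff.2 ((hR₂ t (Ico_subset_Icc_self ht)).trans (le_max_right _ _))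

/-- The derivative, with respect to the parameter, of the final value of the solution of a scalar
ODE is the final value of the solution of the linearized equation. -/
theorem hasDerivAt_final_value (hh : 0 < h) (hδ : 0 < δ)
    (hfc : ContinuousOn (Function.uncurry f) (Icc 0 h ×ˢ (Ioo (-δ) δ ×ˢ univ)))
    (hf : ∀ t ∈ Icc 0 h, ∀ w ∈ Ioo (-δ) δ ×ˢ (univ : Set ℝ), HasFDerivAt (f t) (D t w) w)
    (hD : ContinuousOn (Function.uncurry D) (Icc 0 h ×ˢ (Ioo (-δ) δ ×ˢ univ)))
    (hz : ∀ t ∈ Icc 0 h, HasDerivWithinAt z (f t (0, z t)) (Icc 0 h) t)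
    {ζ : ℝ → ℝ} (hζ0 : ζ 0 = 0)
    (hζ : ∀ t ∈ Icc 0 h, HasDerivWithinAt ζ (D t (0, z t) (1, ζ t)) (Icc 0 h) t)
    {Z : ℝ → ℝ → ℝ} (hZ : ∀ᶠ s in 𝓝 (0 : ℝ), Z s 0 = z 0 ∧
      ∀ t ∈ Icc 0 h, HasDerivWithinAt (Z s) (f t (s, Z s t)) (Icc 0 h) t) :
    HasDerivAt (fun s => Z s h) (ζ h) 0 := by
  have hzc : ContinuousOn z (Icc 0 h) := fun t ht => (hz t ht).continuousWithinAt
  have hζc : ContinuousOn ζ (Icc 0 h) := fun t ht => (hζ t ht).continuousWithinAt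
  have hy : ContinuousOn (fun t => ((0 : ℝ), z t)) (Icc 0 h) := continuousOn_const.prodMk hzc
  have hV : IsOpen (Ioo (-δ) δ ×ˢ (univ : Set ℝ)) := isOpen_Ioo.prod isOpen_univ
  have hyV : ∀ t ∈ Icc 0 h, ((0 : ℝ), z t) ∈ Ioo (-δ) δ ×ˢ (univ : Set ℝ) :=
    fun t _ => ⟨⟨by simpa using hδ, hδ⟩, mem_univ _⟩
  have hDc : ContinuousOn (fun t => D t (0, z t)) (Icc 0 h) :=
    hD.comp (continuousOn_id.prodMk hy) fun t ht => ⟨ht, hyV t ht⟩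
  obtain ⟨K, hK⟩ := isCompact_Icc.exists_bound_of_continuousOn hDc
  have hK0 : 0 ≤ K := (norm_nonneg _).trans (hK 0 ⟨le_rfl, hh.le⟩)
  obtain ⟨C, hC⟩ := eventually_exists_solution hh hδ hfc hf hD hz
  -- The family `Z` is arbitrary; uniqueness identifies it with the solutions constructed above,
  -- hence it inherits their estimate.
  have hZ' : ∀ᶠ s in 𝓝 (0 : ℝ), Z s 0 = z 0 ∧
      (∀ t ∈ Icc 0 h, HasDerivWithinAt (Z s) (f t (s, Z s t)) (Icc 0 h) t) ∧
      ∀ t ∈ Icc 0 h, |Z s t - z t| ≤ C * |s| := by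
    have e3 : ∀ᶠ s in 𝓝 (0 : ℝ), s ∈ Ioo (-δ) δ := Ioo_mem_nhds (by simpa using hδ) hδ
    filter_upwards [hC, hZ, e3] with s ⟨Y, hY0, hY, hYz⟩ ⟨hZ0, hZs⟩ hs
    refine ⟨hZ0, hZs, fun t ht => ?_⟩
    have : EqOn (Z s) Y (Icc 0 h) := by
      refine eqOn_of_solves (F := fun t x => f t (s, x)) (F' := fun t x => D t (s, x) (0, 1))
        (fun t ht x => ?_) ?_ hZs hY (hZ0.trans hY0.symm)
      · have h1 : HasDerivAt (fun x : ℝ => (s, x)) ((0 : ℝ), (1 : ℝ)) x :=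
          (hasDerivAt_const x s).prodMk (hasDerivAt_id x)
        exact (hf t ht (s, x) ⟨hs, mem_univ _⟩).comp_hasDerivAt x h1
      · have : ContinuousOn (fun q : ℝ × ℝ => Function.uncurry D (q.1, (s, q.2)))
            (Icc 0 h ×ˢ univ) :=
          hD.comp (by fun_prop) fun q hq => ⟨hq.1, hs, mem_univ _⟩
        exact this.clm_apply continuousOn_const
    rw [this ht]
    exact hYz t ht
  have hC0 : 0 ≤ |C| := abs_nonneg C
  have hz00 : Z 0 h = z h := by
    have := (hZ'.self_of_nhds).2.2 h ⟨hh.le, le_rfl⟩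
    rw [abs_zero, mul_zero] at this
    exact sub_eq_zero.1 (abs_eq_zero.1 (le_antisymm this (abs_nonneg _)))
  rw [hasDerivAt_iff_isLittleO, Asymptotics.isLittleO_iff]
  intro c hc
  set Q := gronwallBound 0 K (1 + |C|) h with hQ
  have hQ0 : 0 ≤ Q := by
    have := gronwallBound_mono (δ := 0) (ε := 1 + |C|) le_rfl (by positivity) hK0 hh.le
    rwa [gronwallBound_x0] at this
  -- Gronwall will bound the remainder by `Q * (c / (Q + 1)) * |s| ≤ c * |s|`; the `+ 1` avoids
  -- dividing by zero. The factor `1 + |C|` in `Q` comes from `‖(s, Z s t - z t)‖ ≤ (1 + |C|) |s|`.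
  obtain ⟨ρ, hρ, H⟩ := exists_uniform_linearization hV hy hyV hf hD
    (η := c / (Q + 1)) (by positivity)
  have e1 : ∀ᶠ s in 𝓝 (0 : ℝ), (1 + |C|) * |s| < ρ := by
    have : Tendsto (fun s : ℝ => (1 + |C|) * |s|) (𝓝 0) (𝓝 0) := by
      simpa using (show Continuous fun s : ℝ => (1 + |C|) * |s| by fun_prop).tendsto 0
    exact this.eventually (gt_mem_nhds hρ)
  filter_upwards [hZ', e1] with s ⟨hZ0, hZs, hZz⟩ hs
  have near : ∀ t ∈ Icc 0 h, ‖(s, Z s t) - ((0 : ℝ), z t)‖ ≤ (1 + |C|) * |s| := by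
    intro t ht
    rw [Prod.norm_def]
    simp only [Prod.mk_sub_mk, sub_zero, Real.norm_eq_abs]
    have h1 := hZz t ht
    have h2 : C * |s| ≤ |C| * |s| := by gcongr; exact le_abs_self C
    have h3 : 0 ≤ |C| * |s| := by positivity
    exact max_le (by linarith) (by linarith [abs_nonneg s])
  have hgr : ∀ t ∈ Icc 0 h, ‖Z s t - z t - s * ζ t‖ ≤
      gronwallBound 0 K ((1 + |C|) * (c / (Q + 1) * |s|)) (t - 0) := by
    refine norm_le_gronwallBound_of_norm_deriv_right_le (f := fun t => Z s t - z t - s * ζ t)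
      (f' := fun t => f t (s, Z s t) - f t (0, z t) - s * D t (0, z t) (1, ζ t))
      (ContinuousOn.sub (ContinuousOn.sub
        (fun t ht => (hZs t ht).continuousWithinAt) hzc) (continuousOn_const.mul hζc))
      (fun t ht => ?_) (by simp [hZ0, hζ0])
      (fun t ht => ?_)
    · have ht' := Ico_subset_Icc_self ht
      exact HasDerivWithinAt.Ici_of_Icc ht
        (((hZs t ht').sub (hz t ht')).sub ((hζ t ht').const_mul s))
    · have ht' := Ico_subset_Icc_self ht
      have h1 := (H t ht' (0, z t) (s, Z s t) (by simpa using hρ)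
        ((near t ht').trans_lt hs)).2
      have h2 := near t ht'
      have h3 : D t (0, z t) ((s, Z s t) - (0, z t)) - s * D t (0, z t) (1, ζ t) =
          D t (0, z t) (0, Z s t - z t - s * ζ t) := by
        rw [← smul_eq_mul, ← map_smul, ← map_sub]
        congr 1
        ext <;> simp
      have h4 : |D t (0, z t) (0, Z s t - z t - s * ζ t)| ≤ K * ‖Z s t - z t - s * ζ t‖ := by
        refine ((D t (0, z t)).le_opNorm _).trans ?_
        have : ‖((0 : ℝ), Z s t - z t - s * ζ t)‖ = ‖Z s t - z t - s * ζ t‖ := by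
          rw [Prod.norm_def]; simp
        rw [this]
        gcongr
        exact hK t ht'
      -- The derivative of the remainder `Z s - z - s ζ` is a linearization error plus the linear
      -- equation applied to the remainder itself, which is the form Gronwall needs.
      have h5 : f t (s, Z s t) - f t (0, z t) - s * D t (0, z t) (1, ζ t) =
          (f t (s, Z s t) - f t (0, z t) - D t (0, z t) ((s, Z s t) - (0, z t))) +
          D t (0, z t) (0, Z s t - z t - s * ζ t) := by rw [← h3]; ring
      rw [h5, Real.norm_eq_abs]
      refine (abs_add_le _ _).trans ?_
      have h6 : c / (Q + 1) * ‖(s, Z s t) - ((0 : ℝ), z t)‖ ≤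
          (1 + |C|) * (c / (Q + 1) * |s|) := by
        calc _ ≤ c / (Q + 1) * ((1 + |C|) * |s|) := by gcongr
          _ = _ := by ring
      linarith
  have hfin := hgr h ⟨hh.le, le_rfl⟩
  rw [sub_zero, gronwallBound_zero_mul, ← hQ] at hfin
  have : Q * (c / (Q + 1) * |s|) ≤ c * ‖s - 0‖ := by
    rw [sub_zero, Real.norm_eq_abs, ← mul_assoc]
    gcongr
    rw [mul_div_assoc', div_le_iff₀ (by positivity)]
    nlinarith
  rw [hz00, sub_zero, smul_eq_mul]
  exact hfin.trans (by simpa using this)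

end ParametrizedODE

/-! ### Partial derivatives on `[0, h] × V` and variation of constants -/

section Calculus

variable {P Q : Type*} [NormedAddCommGroup P] [NormedSpace ℝ P]
  [NormedAddCommGroup Q] [NormedSpace ℝ Q] {h : ℝ}

theorem uniqueDiffOn_Icc_prod (hh : 0 < h) {V : Set P} (hV : IsOpen V) :
    UniqueDiffOn ℝ (Icc 0 h ×ˢ V) :=
  (uniqueDiffOn_Icc hh).prod hV.uniqueDiffOn

theorem hasFDerivAt_snd_of_contDiffOn {ℓ : ℝ × P → Q} {V : Set P}
    (hV : IsOpen V) (hℓ : ContDiffOn ℝ ∞ ℓ (Icc 0 h ×ˢ V)) {t : ℝ} (ht : t ∈ Icc 0 h) {w : P}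
    (hw : w ∈ V) :
    HasFDerivAt (fun w => ℓ (t, w))
      ((fderivWithin ℝ ℓ (Icc 0 h ×ˢ V) (t, w)).comp (ContinuousLinearMap.inr ℝ ℝ P)) w := by
  have h1 := (hℓ.differentiableOn (by simp) (t, w) ⟨ht, hw⟩).hasFDerivWithinAt
  have h2 : HasFDerivWithinAt (fun w : P => (t, w)) (ContinuousLinearMap.inr ℝ ℝ P) V w :=
    (hasFDerivAt_prodMk_right t w).hasFDerivWithinAt
  exact (h1.comp w h2 fun w' hw' => ⟨ht, hw'⟩).hasFDerivAt (hV.mem_nhds hw)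

theorem hasDerivWithinAt_fst_of_contDiffOn {ℓ : ℝ × P → Q} {V : Set P}
    (hℓ : ContDiffOn ℝ ∞ ℓ (Icc 0 h ×ˢ V)) {t : ℝ} (ht : t ∈ Icc 0 h) {w : P} (hw : w ∈ V) :
    HasDerivWithinAt (fun t => ℓ (t, w))
      (fderivWithin ℝ ℓ (Icc 0 h ×ˢ V) (t, w) (1, 0)) (Icc 0 h) t := by
  have h1 := (hℓ.differentiableOn (by simp) (t, w) ⟨ht, hw⟩).hasFDerivWithinAt
  have h2 : HasDerivWithinAt (fun t : ℝ => (t, w)) ((1 : ℝ), (0 : P)) (Icc 0 h) t :=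
    ((hasDerivAt_id t).prodMk (hasDerivAt_const t w)).hasDerivWithinAt
  have h3 : MapsTo (fun t : ℝ => (t, w)) (Icc 0 h) (Icc 0 h ×ˢ V) := fun t' ht' => ⟨ht', hw⟩
  exact h1.comp_hasDerivWithinAt t h2 h3

theorem contDiffOn_fderiv_snd (hh : 0 < h) {ℓ : ℝ × P → Q} {V : Set P} (hV : IsOpen V)
    (hℓ : ContDiffOn ℝ ∞ ℓ (Icc 0 h ×ˢ V)) :
    ContDiffOn ℝ ∞ (fun q : ℝ × P => fderiv ℝ (fun w => ℓ (q.1, w)) q.2) (Icc 0 h ×ˢ V) := by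
  have h1 : ContDiffOn ℝ ∞ (fun q : ℝ × P => (fderivWithin ℝ ℓ (Icc 0 h ×ˢ V) q).comp
      (ContinuousLinearMap.inr ℝ ℝ P)) (Icc 0 h ×ˢ V) :=
    (hℓ.fderivWithin (uniqueDiffOn_Icc_prod hh hV) (by simp)).clm_comp contDiffOn_const
  exact h1.congr fun q hq => (hasFDerivAt_snd_of_contDiffOn hV hℓ hq.1 hq.2).fderiv

theorem contDiffOn_derivWithin_fst (hh : 0 < h) {ℓ : ℝ × P → Q} {V : Set P} (hV : IsOpen V)
    (hℓ : ContDiffOn ℝ ∞ ℓ (Icc 0 h ×ˢ V)) :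
    ContDiffOn ℝ ∞ (fun q : ℝ × P => derivWithin (fun t => ℓ (t, q.2)) (Icc 0 h) q.1)
      (Icc 0 h ×ˢ V) := by
  have h1 : ContDiffOn ℝ ∞ (fun q : ℝ × P => fderivWithin ℝ ℓ (Icc 0 h ×ˢ V) q (1, 0))
      (Icc 0 h ×ˢ V) :=
    (hℓ.fderivWithin (uniqueDiffOn_Icc_prod hh hV) (by simp)).clm_apply contDiffOn_const
  exact h1.congr fun q hq => (hasDerivWithinAt_fst_of_contDiffOn hℓ hq.1 hq.2).derivWithin
    (uniqueDiffOn_Icc hh q.1 hq.1)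

/-- Equality of mixed partial derivatives on `[0, h] × (-δ, δ)`. -/
theorem exists_mixed_deriv (hh : 0 < h) {δ : ℝ} (hδ : 0 < δ) {u : ℝ × ℝ → Q}
    (hu : ContDiffOn ℝ ∞ u (Icc 0 h ×ˢ Ioo (-δ) δ)) {t : ℝ} (ht : t ∈ Icc 0 h) :
    ∃ w : Q, HasDerivWithinAt (fun t => deriv (fun s => u (t, s)) 0) w (Icc 0 h) t ∧
      HasDerivAt (fun s => derivWithin (fun t => u (t, s)) (Icc 0 h) t) w 0 := by
  set S := Icc 0 h ×ˢ Ioo (-δ) δ with hS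
  have hSu : UniqueDiffOn ℝ S := uniqueDiffOn_Icc_prod hh isOpen_Ioo
  have h0 : (0 : ℝ) ∈ Ioo (-δ) δ := ⟨by simpa using hδ, hδ⟩
  have hu' : ContDiffOn ℝ ∞ (fderivWithin ℝ u S) S := hu.fderivWithin hSu (by simp)
  set D2 := fderivWithin ℝ (fderivWithin ℝ u S) S (t, 0) with hD2
  have hsymm : D2 (1, 0) (0, 1) = D2 (0, 1) (1, 0) := by
    have : IsSymmSndFDerivWithinAt ℝ u S (t, 0) := by
      refine (hu (t, 0) ⟨ht, h0⟩).isSymmSndFDerivWithinAt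
        (by simpa using (mod_cast le_top : ((2 : ℕ∞) : WithTop ℕ∞) ≤ ∞)) hSu ?_ ⟨ht, h0⟩
      -- Symmetry at the end times `t = 0` and `t = h` holds because these points lie in the closure
      -- of the interior of the strip.
      rw [hS, interior_prod_eq, interior_Icc, interior_Ioo, closure_prod_eq, closure_Ioo hh.ne,
        closure_Ioo (by linarith)]
      exact ⟨ht, Ioo_subset_Icc_self h0⟩
    exact this _ _
  refine ⟨D2 (1, 0) (0, 1), ?_, ?_⟩
  · have h1 := (hasDerivWithinAt_fst_of_contDiffOn hu' ht h0).clm_apply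
      (hasDerivWithinAt_const t (Icc 0 h) ((0 : ℝ), (1 : ℝ)))
    simp only [map_zero, add_zero] at h1
    refine h1.congr_of_mem (fun t' ht' => ?_) ht
    have h2 := (hasFDerivAt_snd_of_contDiffOn isOpen_Ioo hu ht' h0).hasDerivAt.deriv
    simpa using h2
  · rw [hsymm]
    have h1 := (hasFDerivAt_snd_of_contDiffOn isOpen_Ioo hu' ht h0).hasDerivAt.clm_apply
      (hasDerivAt_const 0 ((1 : ℝ), (0 : ℝ)))
    simp only [map_zero, add_zero] at h1
    refine HasDerivAt.congr_of_eventuallyEq (by simpa using h1) ?_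
    filter_upwards [Ioo_mem_nhds h0.1 h0.2] with s hs
    exact (hasDerivWithinAt_fst_of_contDiffOn hu ht hs).derivWithin (uniqueDiffOn_Icc hh t ht)

/-- The solution by variation of constants of a linear equation with an inhomogeneity. -/
theorem hasDerivWithinAt_variation_of_constants {b F : ℝ → ℝ}
    (hb : ContinuousOn b (Icc 0 h)) (hF : ContinuousOn F (Icc 0 h)) {t : ℝ} (ht : t ∈ Icc 0 h) :
    HasDerivWithinAt (fun t => Real.exp (∫ τ in (0 : ℝ)..t, b τ) *
        ∫ σ in (0 : ℝ)..t, Real.exp (-∫ τ in (0 : ℝ)..σ, b τ) * F σ)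
      (b t * (Real.exp (∫ τ in (0 : ℝ)..t, b τ) *
        ∫ σ in (0 : ℝ)..t, Real.exp (-∫ τ in (0 : ℝ)..σ, b τ) * F σ) + F t) (Icc 0 h) t := by
  have ftc : ∀ {k : ℝ → ℝ}, ContinuousOn k (Icc 0 h) → ∀ t ∈ Icc 0 h,
      HasDerivWithinAt (fun t => ∫ τ in (0 : ℝ)..t, k τ) (k t) (Icc 0 h) t := by
    intro k hk t ht
    have : Fact (t ∈ Icc 0 h) := ⟨ht⟩
    refine intervalIntegral.integral_hasDerivWithinAt_right
      ((hk.mono ?_).intervalIntegrable) (hk.stronglyMeasurableAtFilter_nhdsWithin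
        measurableSet_Icc t) (hk t ht)
    rw [uIcc_of_le ht.1]
    exact Icc_subset_Icc_right ht.2
  have hbI := ftc hb
  have hbc : ContinuousOn (fun t => ∫ τ in (0 : ℝ)..t, b τ) (Icc 0 h) :=
    fun t ht => (hbI t ht).continuousWithinAt
  have hk : ContinuousOn (fun σ => Real.exp (-∫ τ in (0 : ℝ)..σ, b τ) * F σ) (Icc 0 h) :=
    (Real.continuous_exp.comp_continuousOn hbc.neg).mul hF
  refine ((hbI t ht).exp.mul (ftc hk t ht)).congr_deriv ?_
  rw [← mul_assoc (Real.exp _) (Real.exp _), ← Real.exp_add, add_neg_cancel, Real.exp_zero]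
  ring

end Calculus

/-! ### First variation for a time-dependent Lagrangian on a vector space -/

section Variation

variable {E : Type*} [NormedAddCommGroup E] [NormedSpace ℝ E]

/-- The partial differential, in the last three variables, of a time-dependent Lagrangian
`ℓ (t, x, v, z)`. -/
def spatialFDeriv (ℓ : ℝ × E × E × ℝ → ℝ) (t : ℝ) (x v : E) (z : ℝ) : E × E × ℝ →L[ℝ] ℝ :=
  fderiv ℝ (fun w : E × E × ℝ => ℓ (t, w)) (x, v, z)

/-- The momentum `∂ℓ/∂v`. -/
def momentum (ℓ : ℝ × E × E × ℝ → ℝ) (t : ℝ) (x v : E) (z : ℝ) : E →L[ℝ] ℝ :=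
  (spatialFDeriv ℓ t x v z).comp
    ((ContinuousLinearMap.inr ℝ E (E × ℝ)).comp (ContinuousLinearMap.inl ℝ E ℝ))

/-- The derivative of `ℓ (t, x, v, z)` when `x` moves with velocity `η` and `v` moves with velocity
`B η v`. -/
def force (ℓ : ℝ × E × E × ℝ → ℝ) (B : E →L[ℝ] E →L[ℝ] E) (t : ℝ) (x v : E) (z : ℝ) :
    E →L[ℝ] ℝ :=
  (spatialFDeriv ℓ t x v z).comp (ContinuousLinearMap.inl ℝ E (E × ℝ)) +
    (momentum ℓ t x v z).comp (B.flip v)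

/-- The derivative `∂ℓ/∂z`. -/
def dissipation (ℓ : ℝ × E × E × ℝ → ℝ) (t : ℝ) (x v : E) (z : ℝ) : ℝ :=
  spatialFDeriv ℓ t x v z (0, 0, 1)

theorem spatialFDeriv_apply (ℓ : ℝ × E × E × ℝ → ℝ) (B : E →L[ℝ] E →L[ℝ] E) (t : ℝ) (x v : E)
    (z : ℝ) (η η' : E) (ζ : ℝ) :
    spatialFDeriv ℓ t x v z (η, B η v + η', ζ) =
      force ℓ B t x v z η + momentum ℓ t x v z η' + dissipation ℓ t x v z * ζ := by
  have : ((η, B η v + η', ζ) : E × E × ℝ) =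
      (η, 0, 0) + (0, B η v, 0) + (0, η', 0) + ζ • (0, 0, 1) := by
    ext <;> simp
  rw [this, map_add, map_add, map_add, map_smul]
  simp only [force, momentum, dissipation, add_apply, ContinuousLinearMap.comp_apply,
    ContinuousLinearMap.inl_apply, ContinuousLinearMap.inr_apply, ContinuousLinearMap.flip_apply,
    smul_eq_mul]
  rw [mul_comm ζ]
  rfl

variable {h : ℝ} {T : Set E} {ℓ : ℝ × E × E × ℝ → ℝ} {p : E} {ξ : ℝ → E} {z : ℝ → ℝ}

theorem contDiffOn_spatialFDeriv (hh : 0 < h) (hT : IsOpen T) (hp : p ∈ T)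
    (hℓ : ContDiffOn ℝ ∞ ℓ (Icc 0 h ×ˢ (T ×ˢ univ)))
    {n : ℕ∞} (hξ : ContDiffOn ℝ n ξ (Icc 0 h)) (hz : ContDiffOn ℝ n z (Icc 0 h)) :
    ContDiffOn ℝ n (fun t => spatialFDeriv ℓ t p (ξ t) (z t)) (Icc 0 h) :=
  ((contDiffOn_fderiv_snd hh (hT.prod isOpen_univ) hℓ).of_le (by exact_mod_cast le_top)).comp
    (contDiffOn_id.prodMk (contDiffOn_const.prodMk (hξ.prodMk hz)))
    fun t ht => ⟨ht, hp, mem_univ _⟩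

/-- The defect, in the dual of the Lie algebra, of the Herglotz equation. -/
def defect (h : ℝ) (ℓ : ℝ × E × E × ℝ → ℝ) (B : E →L[ℝ] E →L[ℝ] E) (p : E) (ξ : ℝ → E)
    (z : ℝ → ℝ) (t : ℝ) : E →L[ℝ] ℝ :=
  derivWithin (fun t => momentum ℓ t p (ξ t) (z t)) (Icc 0 h) t
    - force ℓ B t p (ξ t) (z t)
    - dissipation ℓ t p (ξ t) (z t) • momentum ℓ t p (ξ t) (z t)

/-- The equation itself makes `z'` continuous. One derivative is enough, since the momentum is
differentiated only once. -/
theorem contDiffOn_solution (hh : 0 < h) (hp : p ∈ T)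
    (hℓ : ContDiffOn ℝ ∞ ℓ (Icc 0 h ×ˢ (T ×ˢ univ)))
    (hξ : ContDiffOn ℝ ∞ ξ (Icc 0 h))
    (hz : ∀ t ∈ Icc 0 h, HasDerivWithinAt z (ℓ (t, p, ξ t, z t)) (Icc 0 h) t) :
    ContDiffOn ℝ 1 z (Icc 0 h) := by
  have hzc : ContinuousOn z (Icc 0 h) := fun t ht => (hz t ht).continuousWithinAt
  have h1 : ContinuousOn (fun t => ℓ (t, p, ξ t, z t)) (Icc 0 h) :=
    hℓ.continuousOn.comp (continuousOn_id.prodMk (continuousOn_const.prodMk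
      (hξ.continuousOn.prodMk hzc))) fun t ht => ⟨ht, hp, mem_univ _⟩
  rw [show (1 : WithTop ℕ∞) = 0 + 1 by simp,
    contDiffOn_succ_iff_derivWithin (uniqueDiffOn_Icc hh)]
  refine ⟨fun t ht => (hz t ht).differentiableWithinAt, by simp, contDiffOn_zero.2 ?_⟩
  exact h1.congr fun t ht => (hz t ht).derivWithin (uniqueDiffOn_Icc hh t ht)

/-- This makes the `derivWithin` occurring in `defect` a genuine derivative, continuous in time. -/
theorem contDiffOn_momentum (hh : 0 < h) (hT : IsOpen T) (hp : p ∈ T)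
    (hℓ : ContDiffOn ℝ ∞ ℓ (Icc 0 h ×ˢ (T ×ˢ univ)))
    (hξ : ContDiffOn ℝ ∞ ξ (Icc 0 h))
    (hz : ∀ t ∈ Icc 0 h, HasDerivWithinAt z (ℓ (t, p, ξ t, z t)) (Icc 0 h) t) :
    ContDiffOn ℝ 1 (fun t => momentum ℓ t p (ξ t) (z t)) (Icc 0 h) := by
  have h1 : ContDiffOn ℝ (1 : ℕ∞) (fun t => spatialFDeriv ℓ t p (ξ t) (z t)) (Icc 0 h) :=
    contDiffOn_spatialFDeriv hh hT hp hℓ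
    (hξ.of_le (by exact_mod_cast le_top)) (contDiffOn_solution hh hp hℓ hξ hz)
  exact h1.clm_comp contDiffOn_const

theorem continuousOn_dissipation (hh : 0 < h) (hT : IsOpen T) (hp : p ∈ T)
    (hℓ : ContDiffOn ℝ ∞ ℓ (Icc 0 h ×ˢ (T ×ˢ univ)))
    (hξ : ContDiffOn ℝ ∞ ξ (Icc 0 h)) (hz : ContinuousOn z (Icc 0 h)) :
    ContinuousOn (fun t => dissipation ℓ t p (ξ t) (z t)) (Icc 0 h) := by
  have h1 : ContDiffOn ℝ (0 : ℕ∞) (fun t => spatialFDeriv ℓ t p (ξ t) (z t)) (Icc 0 h) :=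
    contDiffOn_spatialFDeriv hh hT hp hℓ
    (hξ.of_le (by exact_mod_cast le_top)) (contDiffOn_zero.2 hz)
  exact h1.continuousOn.clm_apply continuousOn_const

theorem continuousOn_defect (hh : 0 < h) (hT : IsOpen T) (hp : p ∈ T)
    (hℓ : ContDiffOn ℝ ∞ ℓ (Icc 0 h ×ˢ (T ×ˢ univ)))
    (hξ : ContDiffOn ℝ ∞ ξ (Icc 0 h)) (B : E →L[ℝ] E →L[ℝ] E)
    (hz : ∀ t ∈ Icc 0 h, HasDerivWithinAt z (ℓ (t, p, ξ t, z t)) (Icc 0 h) t) :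
    ContinuousOn (defect h ℓ B p ξ z) (Icc 0 h) := by
  have hzc : ContinuousOn z (Icc 0 h) := fun t ht => (hz t ht).continuousWithinAt
  have hμ := contDiffOn_momentum hh hT hp hℓ hξ hz
  have h1 : ContDiffOn ℝ (0 : ℕ∞) (fun t => spatialFDeriv ℓ t p (ξ t) (z t)) (Icc 0 h) :=
    contDiffOn_spatialFDeriv hh hT hp hℓ
    (hξ.of_le (by exact_mod_cast le_top)) (contDiffOn_zero.2 hzc)
  refine ((hμ.continuousOn_derivWithin (uniqueDiffOn_Icc hh) le_rfl).sub ?_).sub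
    ((continuousOn_dissipation hh hT hp hℓ hξ hzc).smul hμ.continuousOn)
  refine (h1.continuousOn.clm_comp continuousOn_const).add (hμ.continuousOn.clm_comp ?_)
  exact B.flip.continuous.comp_continuousOn hξ.continuousOn

variable {δ : ℝ} {u : ℝ × ℝ → E} {N : E → E →L[ℝ] E}

/-- The Lagrangian along a variation written as `(x, v) = (u, N(u) ξ + ∂ₜ u)`. -/
def variedLagrangian (h : ℝ) (ℓ : ℝ × E × E × ℝ → ℝ) (N : E → E →L[ℝ] E) (ξ : ℝ → E)
    (u : ℝ × ℝ → E) (q : ℝ × ℝ × ℝ) : ℝ :=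
  ℓ (q.1, u (q.1, q.2.1),
    N (u (q.1, q.2.1)) (ξ q.1) + derivWithin (fun t => u (t, q.2.1)) (Icc 0 h) q.1, q.2.2)

theorem contDiffOn_variedLagrangian (hh : 0 < h)
    (hℓ : ContDiffOn ℝ ∞ ℓ (Icc 0 h ×ˢ (T ×ˢ univ)))
    (hN : ContDiffOn ℝ ∞ N T) (hξ : ContDiffOn ℝ ∞ ξ (Icc 0 h))
    (hu : ContDiffOn ℝ ∞ u (Icc 0 h ×ˢ Ioo (-δ) δ))
    (huT : MapsTo u (Icc 0 h ×ˢ Ioo (-δ) δ) T) :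
    ContDiffOn ℝ ∞ (variedLagrangian h ℓ N ξ u) (Icc 0 h ×ˢ (Ioo (-δ) δ ×ˢ univ)) := by
  have hpr : ContDiffOn ℝ ∞ (fun q : ℝ × ℝ × ℝ => (q.1, q.2.1))
      (Icc 0 h ×ˢ (Ioo (-δ) δ ×ˢ univ)) := by fun_prop
  have hprm : MapsTo (fun q : ℝ × ℝ × ℝ => (q.1, q.2.1)) (Icc 0 h ×ˢ (Ioo (-δ) δ ×ˢ univ))
      (Icc 0 h ×ˢ Ioo (-δ) δ) := fun q hq => ⟨hq.1, hq.2.1⟩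
  have hu1 := hu.comp hpr hprm
  have hut := (contDiffOn_derivWithin_fst hh isOpen_Ioo hu).comp hpr hprm
  have hNu := hN.comp hu1 fun q hq => huT (hprm hq)
  have hξ1 : ContDiffOn ℝ ∞ (fun q : ℝ × ℝ × ℝ => ξ q.1) (Icc 0 h ×ˢ (Ioo (-δ) δ ×ˢ univ)) :=
    hξ.comp contDiffOn_fst fun q hq => hq.1
  exact hℓ.comp (contDiffOn_fst.prodMk (hu1.prodMk (((hNu.clm_apply hξ1).add hut).prodMk
    (by fun_prop)))) fun q hq => ⟨hq.1, huT (hprm hq), mem_univ _⟩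

/-- Both sides are the derivative at `0` of one scalar function, the varied Lagrangian along `s ↦
(s, x + s ζ)`. At `s = 0` the arguments of `ℓ` are `(p, ξ, x)` because `N p = id` and `∂ₜu = 0`; the
velocity slot then moves at rate `DN(p) η ξ + η'`. -/
theorem fderiv_variedLagrangian_apply (hh : 0 < h) (hδ : 0 < δ) (hT : IsOpen T)
    (hℓ : ContDiffOn ℝ ∞ ℓ (Icc 0 h ×ˢ (T ×ˢ univ)))
    (hN : ContDiffOn ℝ ∞ N T) (hξ : ContDiffOn ℝ ∞ ξ (Icc 0 h)) (hp : p ∈ T)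
    (hNp : N p = ContinuousLinearMap.id ℝ E)
    (hu : ContDiffOn ℝ ∞ u (Icc 0 h ×ˢ Ioo (-δ) δ))
    (huT : MapsTo u (Icc 0 h ×ˢ Ioo (-δ) δ) T) {t : ℝ} (ht : t ∈ Icc 0 h)
    (hu0 : u (t, 0) = p) (hu0' : derivWithin (fun t => u (t, 0)) (Icc 0 h) t = 0) {η η' : E}
    (hη : HasDerivAt (fun s => u (t, s)) η 0)
    (hη' : HasDerivAt (fun s => derivWithin (fun t => u (t, s)) (Icc 0 h) t) η' 0) (x ζ : ℝ) :
    fderiv ℝ (fun w : ℝ × ℝ => variedLagrangian h ℓ N ξ u (t, w)) (0, x) (1, ζ) =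
      force ℓ (fderiv ℝ N p) t p (ξ t) x η + momentum ℓ t p (ξ t) x η' +
        dissipation ℓ t p (ξ t) x * ζ := by
  have hΛ := contDiffOn_variedLagrangian hh hℓ hN hξ hu huT
  have hV : IsOpen (Ioo (-δ) δ ×ˢ (univ : Set ℝ)) := isOpen_Ioo.prod isOpen_univ
  have h0 : (0 : ℝ) ∈ Ioo (-δ) δ := ⟨by simpa using hδ, hδ⟩
  have hd := (hasFDerivAt_snd_of_contDiffOn hV hΛ ht (w := (0, x))
    ⟨h0, mem_univ _⟩).differentiableAt.hasFDerivAt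
  have hzz : HasDerivAt (fun s : ℝ => x + s * ζ) ζ 0 := by
    simpa using ((hasDerivAt_id (0 : ℝ)).mul_const ζ).const_add x
  have hc : HasDerivAt (fun s : ℝ => ((s, x + s * ζ) : ℝ × ℝ)) (1, ζ) 0 :=
    (hasDerivAt_id 0).prodMk hzz
  have h1 := hd.comp_hasDerivAt_of_eq 0 hc (by simp)
  have hN1 : HasFDerivAt N (fderiv ℝ N p) (u (t, 0)) := by
    rw [hu0]
    exact ((hN.differentiableOn (by simp) p hp).differentiableAt (hT.mem_nhds hp)).hasFDerivAt
  have hℓ1 : HasFDerivAt (fun w : E × E × ℝ => ℓ (t, w)) (spatialFDeriv ℓ t p (ξ t) x)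
      (p, ξ t, x) := (hasFDerivAt_snd_of_contDiffOn (hT.prod isOpen_univ) hℓ ht
        ⟨hp, mem_univ _⟩).differentiableAt.hasFDerivAt
  have hv : HasDerivAt (fun s => N (u (t, s)) (ξ t) +
      derivWithin (fun t => u (t, s)) (Icc 0 h) t) (fderiv ℝ N p η (ξ t) + η') 0 := by
    have h5 : HasDerivAt (fun s => N (u (t, s))) (fderiv ℝ N p η) 0 :=
      HasFDerivAt.comp_hasDerivAt (l := N) (f := fun s => u (t, s)) 0 hN1 hη
    have h3 : HasDerivAt (fun s => N (u (t, s)) (ξ t)) (fderiv ℝ N p η (ξ t)) 0 := by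
      simpa using h5.clm_apply (hasDerivAt_const 0 (ξ t))
    exact h3.add hη'
  have h4 : HasDerivAt (fun s => (u (t, s), N (u (t, s)) (ξ t) +
      derivWithin (fun t => u (t, s)) (Icc 0 h) t, x + s * ζ))
      (η, fderiv ℝ N p η (ξ t) + η', ζ) 0 := hη.prodMk (hv.prodMk hzz)
  have h2 := hℓ1.comp_hasDerivAt_of_eq 0 h4
    (by simp [hu0, hu0', hNp])
  rw [← spatialFDeriv_apply]
  exact h1.unique h2

/-- First variation formula, in terms of the defect of the Herglotz equation. -/
theorem hasDerivAt_final_value_variation (hh : 0 < h) (hδ : 0 < δ) (hT : IsOpen T)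
    (hℓ : ContDiffOn ℝ ∞ ℓ (Icc 0 h ×ˢ (T ×ˢ univ)))
    (hN : ContDiffOn ℝ ∞ N T) (hξ : ContDiffOn ℝ ∞ ξ (Icc 0 h)) (hp : p ∈ T)
    (hNp : N p = ContinuousLinearMap.id ℝ E)
    (hu : ContDiffOn ℝ ∞ u (Icc 0 h ×ˢ Ioo (-δ) δ))
    (huT : MapsTo u (Icc 0 h ×ˢ Ioo (-δ) δ) T) (hu0 : ∀ t ∈ Icc 0 h, u (t, 0) = p)
    (hul : ∀ᶠ s in 𝓝 (0 : ℝ), u (0, s) = p) (hur : ∀ᶠ s in 𝓝 (0 : ℝ), u (h, s) = p)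
    (hz : ∀ t ∈ Icc 0 h, HasDerivWithinAt z (ℓ (t, p, ξ t, z t)) (Icc 0 h) t)
    {Z : ℝ → ℝ → ℝ} (hZ : ∀ᶠ s in 𝓝 (0 : ℝ), Z s 0 = z 0 ∧
      ∀ t ∈ Icc 0 h, HasDerivWithinAt (Z s) (variedLagrangian h ℓ N ξ u (t, s, Z s t))
        (Icc 0 h) t) :
    HasDerivAt (fun s => Z s h)
      (-(Real.exp (∫ τ in (0 : ℝ)..h, dissipation ℓ τ p (ξ τ) (z τ)) *
        ∫ σ in (0 : ℝ)..h, Real.exp (-∫ τ in (0 : ℝ)..σ, dissipation ℓ τ p (ξ τ) (z τ)) *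
          defect h ℓ (fderiv ℝ N p) p ξ z σ (deriv (fun s => u (σ, s)) 0))) 0 := by
  have hzc : ContinuousOn z (Icc 0 h) := fun t ht => (hz t ht).continuousWithinAt
  have hΛ := contDiffOn_variedLagrangian hh hℓ hN hξ hu huT
  have hV : IsOpen (Ioo (-δ) δ ×ˢ (univ : Set ℝ)) := isOpen_Ioo.prod isOpen_univ
  have h0 : (0 : ℝ) ∈ Ioo (-δ) δ := ⟨by simpa using hδ, hδ⟩
  have hu0' : ∀ t ∈ Icc 0 h, derivWithin (fun t => u (t, 0)) (Icc 0 h) t = 0 := fun t ht => by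
    rw [derivWithin_congr (f := fun _ => p) hu0 (hu0 t ht), derivWithin_fun_const]
    simp
  have hΛ0 : ∀ t ∈ Icc 0 h, ∀ x, variedLagrangian h ℓ N ξ u (t, 0, x) = ℓ (t, p, ξ t, x) :=
    fun t ht x => by
      simp [variedLagrangian, hu0' t ht, hu0 t ht, hNp]
  -- By equality of mixed derivatives one vector `η'` serves both as `∂ₜ∂ₛu` and as `∂ₛ∂ₜu`:
  -- variation and time derivative commute.
  have hmixed := fun t ht => exists_mixed_deriv hh hδ hu (t := t) ht
  choose! η' hη hη' using hmixed
  set η := fun t => deriv (fun s => u (t, s)) 0 with hηdef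
  have hη0 : η 0 = 0 := by
    rw [hηdef]
    simp only
    rw [Filter.EventuallyEq.deriv_eq (f := fun _ => p) hul, deriv_const]
  have hηh : η h = 0 := by
    rw [hηdef]
    simp only
    rw [Filter.EventuallyEq.deriv_eq (f := fun _ => p) hur, deriv_const]
  have hus : ∀ t ∈ Icc 0 h, HasDerivAt (fun s => u (t, s)) (η t) 0 := fun t ht =>
    (hasFDerivAt_snd_of_contDiffOn isOpen_Ioo hu ht h0).differentiableAt.hasDerivAt
  set B := fderiv ℝ N p with hB
  set b := fun t => dissipation ℓ t p (ξ t) (z t) with hb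
  set F := fun t => defect h ℓ B p ξ z t (η t) with hF
  have hbc : ContinuousOn b (Icc 0 h) := continuousOn_dissipation hh hT hp hℓ hξ hzc
  have hFc : ContinuousOn F (Icc 0 h) :=
    (continuousOn_defect hh hT hp hℓ hξ B hz).clm_apply fun t ht => (hη t ht).continuousWithinAt
  set I := fun t => Real.exp (∫ τ in (0 : ℝ)..t, b τ) *
        ∫ σ in (0 : ℝ)..t, Real.exp (-∫ τ in (0 : ℝ)..σ, b τ) * F σ with hI
  have hIode := fun t (ht : t ∈ Icc 0 h) => hasDerivWithinAt_variation_of_constants hbc hFc ht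
  have hμ := contDiffOn_momentum hh hT hp hℓ hξ hz
  -- The function `μ(η) - I` solves the linearized equation: `μ' = defect + force + b μ` gives
  -- `(μ(η))' = force(η) + μ(η') + b μ(η) + defect(η)`, and `I' = b I + defect(η)` removes the
  -- defect. At `h` only `-I(h)` survives.
  have key := hasDerivAt_final_value (h := h) (δ := δ)
    (f := fun t w => variedLagrangian h ℓ N ξ u (t, w))
    (D := fun t w => fderiv ℝ (fun w : ℝ × ℝ => variedLagrangian h ℓ N ξ u (t, w)) w)
    (z := z) (ζ := fun t => momentum ℓ t p (ξ t) (z t) (η t) - I t) (Z := Z)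
    hh hδ hΛ.continuousOn (fun t ht w hw => (hasFDerivAt_snd_of_contDiffOn hV hΛ ht
      hw).differentiableAt.hasFDerivAt) (contDiffOn_fderiv_snd hh hV hΛ).continuousOn
    (fun t ht => by rw [hΛ0 t ht]; exact hz t ht) (by simp [hη0, hI]) (fun t ht => ?_) hZ
  · simpa only [hηh, map_zero, zero_sub] using key
  · rw [fderiv_variedLagrangian_apply hh hδ hT hℓ hN hξ hp hNp hu huT ht (hu0 t ht) (hu0' t ht)
      (hus t ht) (hη' t ht)]
    have h1 := (((hμ.differentiableOn one_ne_zero t ht).hasDerivWithinAt).clm_apply (hη t ht)).sub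
      (hIode t ht)
    refine h1.congr_deriv ?_
    simp only [hF, hI, hb, defect, sub_apply, smul_apply,
      smul_eq_mul]
    ring

end Variation

theorem mk_congr {E : Type*} [NormedAddCommGroup E] [NormedSpace ℝ E]
    {G : Type*} [TopologicalSpace G] [ChartedSpace E G] {a b : G} {v w : E}
    (h : a = b) (h' : v = w) :
    (⟨a, v⟩ : TangentBundle 𝓘(ℝ, E) G) = ⟨b, w⟩ := by
  subst h h'; rfl

/-! ### The group law in the chart at the identity -/

section ChartAtIdentity

variable (E : Type*) [NormedAddCommGroup E] [NormedSpace ℝ E]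
  (G : Type*) [TopologicalSpace G] [ChartedSpace E G] [Group G]

/-- The preferred chart at the identity. -/
abbrev chartOne : PartialEquiv G E := extChartAt 𝓘(ℝ, E) (1 : G)

/-- The group multiplication read in the chart at the identity. -/
def chartMul (q : E × E) : E :=
  chartOne E G ((chartOne E G).symm q.1 * (chartOne E G).symm q.2)

/-- The set of pairs whose product, read in the chart at the identity, makes sense. -/
def chartMulDomain : Set (E × E) :=
  {q | q ∈ (chartOne E G).target ×ˢ (chartOne E G).target ∧
    (chartOne E G).symm q.1 * (chartOne E G).symm q.2 ∈ (chartOne E G).source}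

/-- The differential at the identity of the left translation by a point of the chart. -/
def chartLeft (x : E) : E →L[ℝ] E :=
  (fderiv ℝ (chartMul E G) (x, chartOne E G 1)).comp (ContinuousLinearMap.inr ℝ E E)

/-- The differential at the identity of the right translation by a point of the chart. -/
def chartRight (x : E) : E →L[ℝ] E :=
  (fderiv ℝ (chartMul E G) (chartOne E G 1, x)).comp (ContinuousLinearMap.inl ℝ E E)

variable {E G}

/-- The parametrization `x ↦ a φ⁻¹(x)` of a neighbourhood of `a`. -/
def chartTranslate (a : G) (x : E) : G := a * (chartOne E G).symm x

/-- The differential of `chartTranslate a`. -/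
def chartTangent (a : G) (x : E) : E →L[ℝ] E :=
  (mfderiv 𝓘(ℝ, E) 𝓘(ℝ, E) (chartTranslate (E := E) a) x :)

theorem isOpen_chartOne_target : IsOpen (chartOne E G).target :=
  isOpen_extChartAt_target (1 : G)

theorem chartOne_one_mem : chartOne E G 1 ∈ (chartOne E G).target :=
  mem_extChartAt_target (1 : G)

theorem chartOne_symm_one : (chartOne E G).symm (chartOne E G 1) = 1 := by simp

theorem one_left_mem_chartMulDomain {x : E} (hx : x ∈ (chartOne E G).target) :
    (chartOne E G 1, x) ∈ chartMulDomain E G := by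
  refine ⟨⟨chartOne_one_mem, hx⟩, ?_⟩
  rw [chartOne_symm_one, one_mul]
  exact (chartOne E G).map_target hx

theorem one_right_mem_chartMulDomain {x : E} (hx : x ∈ (chartOne E G).target) :
    (x, chartOne E G 1) ∈ chartMulDomain E G := by
  refine ⟨⟨hx, chartOne_one_mem⟩, ?_⟩
  rw [chartOne_symm_one, mul_one]
  exact (chartOne E G).map_target hx

theorem chartMul_one_left {x : E} (hx : x ∈ (chartOne E G).target) :
    chartMul E G (chartOne E G 1, x) = x := by
  rw [chartMul, chartOne_symm_one, one_mul, (chartOne E G).right_inv hx]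

theorem chartMul_one_right {x : E} (hx : x ∈ (chartOne E G).target) :
    chartMul E G (x, chartOne E G 1) = x := by
  rw [chartMul, chartOne_symm_one, mul_one, (chartOne E G).right_inv hx]

theorem chartTranslate_one (a : G) : chartTranslate a (chartOne E G 1) = a := by
  rw [chartTranslate, chartOne_symm_one, mul_one]

variable [LieGroup 𝓘(ℝ, E) ∞ G]

theorem contMDiffOn_chartOne :
    ContMDiffOn 𝓘(ℝ, E) 𝓘(ℝ, E) ∞ (chartOne E G) (chartOne E G).source := by
  rw [extChartAt_source]
  exact contMDiffOn_extChartAt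

theorem contMDiffOn_chartOne_symm :
    ContMDiffOn 𝓘(ℝ, E) 𝓘(ℝ, E) ∞ (chartOne E G).symm (chartOne E G).target :=
  contMDiffOn_extChartAt_symm (1 : G)

theorem contMDiffOn_chartTranslate :
    ContMDiffOn (𝓘(ℝ, E).prod 𝓘(ℝ, E)) 𝓘(ℝ, E) ∞
      (fun q : G × E => chartTranslate q.1 q.2) (univ ×ˢ (chartOne E G).target) :=
  contMDiffOn_fst.mul (contMDiffOn_chartOne_symm.comp contMDiffOn_snd fun _ hq => hq.2)

theorem mdifferentiableAt_chartTranslate (a : G) {x : E} (hx : x ∈ (chartOne E G).target) :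
    MDifferentiableAt 𝓘(ℝ, E) 𝓘(ℝ, E) (chartTranslate (E := E) a) x := by
  have h1 : ContMDiffOn 𝓘(ℝ, E) 𝓘(ℝ, E) ∞ (chartTranslate (E := E) a) (chartOne E G).target :=
    contMDiffOn_const.mul contMDiffOn_chartOne_symm
  exact (h1.contMDiffAt (isOpen_chartOne_target.mem_nhds hx)).mdifferentiableAt (by simp)

theorem isOpen_chartMulDomain : IsOpen (chartMulDomain E G) := by
  have h1 : ContMDiffOn (𝓘(ℝ, E).prod 𝓘(ℝ, E)) 𝓘(ℝ, E) ∞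
      (fun q : E × E => (chartOne E G).symm q.1 * (chartOne E G).symm q.2)
      ((chartOne E G).target ×ˢ (chartOne E G).target) :=
    (contMDiffOn_chartOne_symm.comp contMDiffOn_fst fun q hq => hq.1).mul
      (contMDiffOn_chartOne_symm.comp contMDiffOn_snd fun q hq => hq.2)
  exact h1.continuousOn.isOpen_inter_preimage
    (isOpen_chartOne_target.prod isOpen_chartOne_target) (isOpen_extChartAt_source (1 : G))

theorem contDiffOn_chartMul : ContDiffOn ℝ ∞ (chartMul E G) (chartMulDomain E G) := by
  rw [← contMDiffOn_iff_contDiffOn]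
  exact contMDiffOn_chartOne.comp
    ((contMDiffOn_chartOne_symm.comp contDiff_fst.contMDiff.contMDiffOn fun _ hq => hq.1.1).mul
      (contMDiffOn_chartOne_symm.comp contDiff_snd.contMDiff.contMDiffOn fun _ hq => hq.1.2))
    fun _ hq => hq.2

theorem hasFDerivAt_chartMul {q : E × E} (hq : q ∈ chartMulDomain E G) :
    HasFDerivAt (chartMul E G) (fderiv ℝ (chartMul E G) q) q :=
  ((contDiffOn_chartMul.differentiableOn (by simp) q hq).differentiableAt
    (isOpen_chartMulDomain.mem_nhds hq)).hasFDerivAt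

theorem contDiffOn_fderiv_chartMul :
    ContDiffOn ℝ ∞ (fderiv ℝ (chartMul E G)) (chartMulDomain E G) :=
  contDiffOn_chartMul.fderiv_of_isOpen isOpen_chartMulDomain (by simp)

theorem contDiffOn_chartLeft : ContDiffOn ℝ ∞ (chartLeft E G) (chartOne E G).target :=
  ((contDiffOn_fderiv_chartMul (E := E) (G := G)).comp (contDiffOn_id.prodMk contDiffOn_const)
    fun _ hx => one_right_mem_chartMulDomain hx).clm_comp contDiffOn_const

theorem contDiffOn_chartRight : ContDiffOn ℝ ∞ (chartRight E G) (chartOne E G).target :=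
  ((contDiffOn_fderiv_chartMul (E := E) (G := G)).comp (contDiffOn_const.prodMk contDiffOn_id)
    fun _ hx => one_left_mem_chartMulDomain hx).clm_comp contDiffOn_const

theorem fderiv_chartMul_one_left {x : E} (hx : x ∈ (chartOne E G).target) (v : E) :
    fderiv ℝ (chartMul E G) (chartOne E G 1, x) (0, v) = v := by
  have h1 := (hasFDerivAt_chartMul (one_left_mem_chartMulDomain hx)).comp x
    (hasFDerivAt_prodMk_right (chartOne E G 1) x)
  have h2 : HasFDerivAt (chartMul E G ∘ fun y => (chartOne E G 1, y))
      (ContinuousLinearMap.id ℝ E) x := by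
    refine (hasFDerivAt_id x).congr_of_eventuallyEq ?_
    filter_upwards [isOpen_chartOne_target.mem_nhds hx] with y hy using chartMul_one_left hy
  exact congrArg (fun A : E →L[ℝ] E => A v) (h1.unique h2)

theorem fderiv_chartMul_one_right {x : E} (hx : x ∈ (chartOne E G).target) (v : E) :
    fderiv ℝ (chartMul E G) (x, chartOne E G 1) (v, 0) = v := by
  have h1 := (hasFDerivAt_chartMul (one_right_mem_chartMulDomain hx)).comp x
    (hasFDerivAt_prodMk_left (𝕜 := ℝ) x (chartOne E G 1))
  have h2 : HasFDerivAt (chartMul E G ∘ fun y => (y, chartOne E G 1))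
      (ContinuousLinearMap.id ℝ E) x := by
    refine (hasFDerivAt_id x).congr_of_eventuallyEq ?_
    filter_upwards [isOpen_chartOne_target.mem_nhds hx] with y hy using chartMul_one_right hy
  exact congrArg (fun A : E →L[ℝ] E => A v) (h1.unique h2)

theorem chartRight_one : chartRight E G (chartOne E G 1) = ContinuousLinearMap.id ℝ E := by
  ext v
  exact fderiv_chartMul_one_right chartOne_one_mem v

theorem chartLeft_one : chartLeft E G (chartOne E G 1) = ContinuousLinearMap.id ℝ E := by
  ext v
  exact fderiv_chartMul_one_left chartOne_one_mem v

/-- The inverse of the preferred chart has the identity as differential at its base point, so no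
chart factor appears when comparing with the intrinsic left translation. -/
theorem chartTangent_one (a : G) (v : E) :
    chartTangent a (chartOne E G 1) v = leftTangent (E := E) a v := by
  have h1 : MDifferentiableAt 𝓘(ℝ, E) 𝓘(ℝ, E) (fun x : G => a * x) 1 :=
    (contMDiff_mul_left (n := ∞)).contMDiffAt.mdifferentiableAt (by simp)
  have h2 := mfderivWithin_range_extChartAt_symm (I := 𝓘(ℝ, E)) (x := (1 : G))
  have h3 : MDifferentiableAt 𝓘(ℝ, E) 𝓘(ℝ, E) (chartOne E G).symm (chartOne E G 1) :=
    (contMDiffOn_chartOne_symm.contMDiffAt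
      (isOpen_chartOne_target.mem_nhds chartOne_one_mem)).mdifferentiableAt (by simp)
  rw [modelWithCornersSelf_coe, range_id, mfderivWithin_univ] at h2
  have h4 := mfderiv_comp_apply_of_eq (chartOne E G 1) h1 h3 chartOne_symm_one v
  rw [h2] at h4
  exact h4

/-- The tangent map of the left translation by a product in the chart. -/
theorem chartTangent_chartLeft (a : G) {x : E} (hx : x ∈ (chartOne E G).target) (v : E) :
    chartTangent a x (chartLeft E G x v) = leftTangent (E := E) (chartTranslate a x) v := by
  have h0 := one_right_mem_chartMulDomain hx
  have h1 : HasFDerivAt (fun y => chartMul E G (x, y)) (chartLeft E G x) (chartOne E G 1) :=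
    (hasFDerivAt_chartMul h0).comp _ (hasFDerivAt_prodMk_right x (chartOne E G 1))
  have h2 := mfderiv_comp_apply_of_eq (chartOne E G 1) (mdifferentiableAt_chartTranslate a hx)
    h1.differentiableAt.mdifferentiableAt (chartMul_one_right hx) v
  rw [mfderiv_eq_fderiv, h1.fderiv] at h2
  rw [← chartTangent_one (chartTranslate a x) v]
  refine h2.symm.trans ?_
  -- Associativity: near `p`, `a φ⁻¹(m(x, y)) = (a φ⁻¹(x)) φ⁻¹(y)`. Differentiating in `y` at `p`
  -- gives the claim.
  have h3 : chartTranslate a ∘ (fun y => chartMul E G (x, y)) =ᶠ[𝓝 (chartOne E G 1)]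
      chartTranslate (chartTranslate a x) := by
    have h4 : ∀ᶠ y in 𝓝 (chartOne E G 1), (x, y) ∈ chartMulDomain E G :=
      (Continuous.prodMk_right x).continuousAt.eventually (isOpen_chartMulDomain.mem_nhds h0)
    filter_upwards [h4] with y hy
    simp only [Function.comp_apply, chartTranslate, chartMul]
    rw [(chartOne E G).left_inv hy.2, mul_assoc]
  exact congrArg (fun A : E →L[ℝ] E => A v) h3.mfderiv_eq

theorem leftTrivialize_leftTangent (a : G) (v : GroupLieAlgebra 𝓘(ℝ, E) G) :
    leftTrivialize (⟨a, leftTangent a v⟩ : TangentBundle 𝓘(ℝ, E) G) = v := by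
  have h1 : ∀ b x : G, MDifferentiableAt 𝓘(ℝ, E) 𝓘(ℝ, E) (fun x : G => b * x) x := fun b x =>
    (contMDiff_mul_left (n := ∞)).contMDiffAt.mdifferentiableAt (by simp)
  have h2 := mfderiv_comp_apply_of_eq (1 : G) (h1 a⁻¹ a) (h1 a 1) (mul_one a) v
  have h3 : (fun x : G => a⁻¹ * x) ∘ (fun x => a * x) = id := by ext x; simp
  rw [h3, mfderiv_id] at h2
  exact h2.symm

end ChartAtIdentity

/-! ### The Lie bracket and the Lagrangian in the chart -/

section ChartLagrangian

variable {E : Type*} [NormedAddCommGroup E] [NormedSpace ℝ E]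
  {G : Type*} [TopologicalSpace G] [ChartedSpace E G] [Group G] [LieGroup 𝓘(ℝ, E) ∞ G]

theorem inverse_apply_eq_of_isInvertible {F F' : Type*} [TopologicalSpace F] [AddCommGroup F]
    [Module ℝ F] [TopologicalSpace F'] [AddCommGroup F'] [Module ℝ F'] {A : F →L[ℝ] F'}
    (hA : A.IsInvertible) {b : F'} {c : F} (h : A c = b) : A.inverse b = c := by
  obtain ⟨e, rfl⟩ := hA
  rw [ContinuousLinearMap.inverse_equiv, ← h]
  exact e.symm_apply_apply c

/-- The Lie bracket read in the chart at the identity. -/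
theorem bracket_eq_fderiv [FiniteDimensional ℝ E] (v w : GroupLieAlgebra 𝓘(ℝ, E) G) :
    (⁅v, w⁆ : GroupLieAlgebra 𝓘(ℝ, E) G) =
      (fderiv ℝ (chartRight E G) (chartOne E G 1) : E →L[ℝ] E →L[ℝ] E) w v -
        (fderiv ℝ (chartLeft E G) (chartOne E G 1) : E →L[ℝ] E →L[ℝ] E) w v := by
  set p := chartOne E G 1 with hp
  have hpT : p ∈ (chartOne E G).target := chartOne_one_mem
  -- Both sides are the mixed second derivative of the multiplication at `(p, p)`, in the directions
  -- `(a, 0)` and `(0, b)`.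
  have hsymm : ∀ a b : E, (fderiv ℝ (chartRight E G) p : E →L[ℝ] E →L[ℝ] E) b a =
      (fderiv ℝ (chartLeft E G) p : E →L[ℝ] E →L[ℝ] E) a b := by
    intro a b
    have h0 := one_left_mem_chartMulDomain (E := E) (G := G) hpT
    have hs : IsSymmSndFDerivAt ℝ (chartMul E G) (p, p) :=
      (contDiffOn_chartMul.contDiffAt (isOpen_chartMulDomain.mem_nhds h0)).isSymmSndFDerivAt
        (by simpa using (mod_cast le_top : ((2 : ℕ∞) : WithTop ℕ∞) ≤ ∞))
    have hd : HasFDerivAt (fderiv ℝ (chartMul E G))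
        (fderiv ℝ (fderiv ℝ (chartMul E G)) (p, p)) (p, p) :=
      ((contDiffOn_fderiv_chartMul.differentiableOn (by simp) _ h0).differentiableAt
        (isOpen_chartMulDomain.mem_nhds h0)).hasFDerivAt
    have hR : (fderiv ℝ (chartRight E G) p : E →L[ℝ] E →L[ℝ] E) b a =
        fderiv ℝ (fderiv ℝ (chartMul E G)) (p, p) (0, b) (a, 0) := by
      have h1 : HasFDerivAt (chartRight E G) _ p :=
        (hd.comp p (hasFDerivAt_prodMk_right p p)).clm_comp
          (hasFDerivAt_const (ContinuousLinearMap.inl ℝ E E) p)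
      rw [h1.fderiv]
      simp
    have hL : (fderiv ℝ (chartLeft E G) p : E →L[ℝ] E →L[ℝ] E) a b =
        fderiv ℝ (fderiv ℝ (chartMul E G)) (p, p) (a, 0) (0, b) := by
      have h1 : HasFDerivAt (chartLeft E G) _ p :=
        (HasFDerivAt.comp (f := fun e => (e, p)) p hd (hasFDerivAt_prodMk_left p p)).clm_comp
          (hasFDerivAt_const (ContinuousLinearMap.inr ℝ E E) p)
      rw [h1.fderiv]
      simp
    rw [hR, hL, hs]
  -- In the chart, the left-invariant field generated by `v` is `y ↦ chartLeft y v`, so the bracket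
  -- becomes a Lie bracket of vector fields on `E`.
  have hfield : ∀ v : GroupLieAlgebra 𝓘(ℝ, E) G,
      VectorField.mpullbackWithin 𝓘(ℝ, E) 𝓘(ℝ, E) (extChartAt 𝓘(ℝ, E) (1 : G)).symm
        (mulInvariantVectorField v) (range 𝓘(ℝ, E)) =ᶠ[𝓝 p] fun y => chartLeft E G y v := by
    intro v
    filter_upwards [isOpen_chartOne_target.mem_nhds hpT] with y hy
    rw [VectorField.mpullbackWithin_apply]
    have h1 := chartTangent_chartLeft (1 : G) hy v
    have h2 := isInvertible_mfderivWithin_extChartAt_symm (I := 𝓘(ℝ, E)) hy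
    have h3 : chartTranslate (E := E) (1 : G) = (chartOne E G).symm := by
      ext x; exact one_mul _
    rw [chartTangent, h3] at h1
    rw [modelWithCornersSelf_coe, range_id, mfderivWithin_univ] at h2 ⊢
    exact inverse_apply_eq_of_isInvertible h2 h1
  rw [GroupLieAlgebra.bracket_def, VectorField.mlieBracket, VectorField.mlieBracketWithin_apply,
    modelWithCornersSelf_coe, range_id, preimage_univ, inter_univ]
  rw [modelWithCornersSelf_coe, range_id] at hfield
  refine inverse_apply_eq_of_isInvertible
    (isInvertible_mfderiv_extChartAt (mem_extChartAt_source (1 : G))) ?_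
  refine (congrArg (fun A : E →L[ℝ] E => A _) mfderiv_extChartAt_self).trans ?_
  refine Eq.trans ?_ (((congrFun VectorField.lieBracketWithin_univ p).trans
    ((hfield v).lieBracket_vectorField_eq (hfield w))).symm)
  refine Eq.symm ?_
  have hd : ∀ a : E, HasFDerivAt (fun y => chartLeft E G y a)
      ((fderiv ℝ (chartLeft E G) p).flip a) p := fun a => by
    simpa using ((contDiffOn_chartLeft.differentiableOn (by simp) p hpT).differentiableAt
      (isOpen_chartOne_target.mem_nhds hpT)).hasFDerivAt.clm_apply (hasFDerivAt_const a p)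
  have hlb : ∀ a b : E, VectorField.lieBracket ℝ (fun y => chartLeft E G y a)
      (fun y => chartLeft E G y b) p = (fderiv ℝ (chartRight E G) p : E →L[ℝ] E →L[ℝ] E) b a -
        (fderiv ℝ (chartLeft E G) p : E →L[ℝ] E →L[ℝ] E) b a := by
    intro a b
    rw [hsymm, VectorField.lieBracket_eq]
    simp only [(hd _).fderiv]
    rw [hp, chartLeft_one]
    rfl
  exact hlb v w

/-- The Lagrangian along a curve `g`, in the chart at the identity translated by `g t`. -/
def chartLagrangian (L : TangentBundle 𝓘(ℝ, E) G × ℝ → ℝ) (g : ℝ → G) (q : ℝ × E × E × ℝ) : ℝ :=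
  L (⟨chartTranslate (g q.1) q.2.1, chartTangent (g q.1) q.2.1 q.2.2.1⟩, q.2.2.2)

variable {L : TangentBundle 𝓘(ℝ, E) G × ℝ → ℝ} {g : ℝ → G} {h : ℝ}

/-- The argument of `L` is the tangent map of the smooth map `(a, x) ↦ a φ⁻¹(x)`, evaluated on the
vector `(0, v)` at `(g t, x)`. The zero section supplies the first component, which yields
smoothness jointly in `t` as well. -/
theorem contDiffOn_chartLagrangian
    (hL : ContMDiff (𝓘(ℝ, E).tangent.prod 𝓘(ℝ, ℝ)) 𝓘(ℝ, ℝ) ∞ L)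
    (hg : ContMDiffOn 𝓘(ℝ, ℝ) 𝓘(ℝ, E) ∞ g (Icc 0 h)) :
    ContDiffOn ℝ ∞ (chartLagrangian L g) (Icc 0 h ×ˢ ((chartOne E G).target ×ˢ univ)) := by
  set S : Set (ℝ × E × E × ℝ) := Icc 0 h ×ˢ ((chartOne E G).target ×ˢ univ)
  have hopen : IsOpen ((univ : Set G) ×ˢ (chartOne E G).target) :=
    isOpen_univ.prod isOpen_chartOne_target
  have h1 := (contMDiffOn_chartTranslate (E := E) (G := G)).contMDiffOn_tangentMapWithin
    (m := ∞) (by simp) hopen.uniqueMDiffOn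
  have hg' : ContMDiffOn 𝓘(ℝ, ℝ × E × E × ℝ) 𝓘(ℝ, E) ∞ (fun q : ℝ × E × E × ℝ => g q.1) S :=
    hg.comp contDiff_fst.contMDiff.contMDiffOn fun q hq => hq.1
  have h2 : ContMDiffOn 𝓘(ℝ, ℝ × E × E × ℝ) 𝓘(ℝ, E).tangent ∞
      (fun q : ℝ × E × E × ℝ => (⟨g q.1, 0⟩ : TangentBundle 𝓘(ℝ, E) G)) S :=
    ContMDiff.comp_contMDiffOn (g := fun a : G => (⟨a, 0⟩ : TangentBundle 𝓘(ℝ, E) G))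
      (Bundle.contMDiff_zeroSection _ _) hg'
  have h3 : ContMDiffOn 𝓘(ℝ, ℝ × E × E × ℝ) 𝓘(ℝ, E).tangent ∞
      (fun q : ℝ × E × E × ℝ => (⟨q.2.1, q.2.2.1⟩ : TangentBundle 𝓘(ℝ, E) E)) S := by
    intro q hq
    refine Bundle.contMDiffWithinAt_totalSpace.2
      ⟨(ContDiff.contMDiff (by fun_prop)).contMDiffOn q hq, ?_⟩
    have h7 : ContMDiffOn 𝓘(ℝ, ℝ × E × E × ℝ) 𝓘(ℝ, E) ∞
        (fun q : ℝ × E × E × ℝ => q.2.2.1) S := (ContDiff.contMDiff (by fun_prop)).contMDiffOn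
    convert! h7 q hq with y
    simp
  have h4 : ContMDiffOn 𝓘(ℝ, ℝ × E × E × ℝ) (𝓘(ℝ, E).prod 𝓘(ℝ, E)).tangent ∞
      (fun q : ℝ × E × E × ℝ => (⟨(g q.1, q.2.1), ((0 : E), q.2.2.1)⟩ :
        TangentBundle (𝓘(ℝ, E).prod 𝓘(ℝ, E)) (G × E))) S :=
    (contMDiff_equivTangentBundleProd_symm (I := 𝓘(ℝ, E)) (I' := 𝓘(ℝ, E))
      (M := G) (M' := E)).comp_contMDiffOn (h2.prodMk h3)
  have h5 := h1.comp h4 fun q hq => ⟨mem_univ _, hq.2.1⟩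
  have h6 : ContMDiffOn 𝓘(ℝ, ℝ × E × E × ℝ) 𝓘(ℝ, ℝ) ∞ (fun q : ℝ × E × E × ℝ => q.2.2.2) S :=
    (ContDiff.contMDiff (by fun_prop)).contMDiffOn
  rw [← contMDiffOn_iff_contDiffOn]
  refine (hL.comp_contMDiffOn (h5.prodMk h6)).congr fun q hq => ?_
  have hd : MDifferentiableAt (𝓘(ℝ, E).prod 𝓘(ℝ, E)) 𝓘(ℝ, E)
      (fun q : G × E => chartTranslate q.1 q.2) (g q.1, q.2.1) :=
    (contMDiffOn_chartTranslate.contMDiffAt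
      (hopen.mem_nhds ⟨mem_univ _, hq.2.1⟩)).mdifferentiableAt (by simp)
  simp only [chartLagrangian, Function.comp_apply]
  refine congrArg L (Prod.ext (mk_congr rfl ?_) rfl)
  rw [mfderivWithin_of_isOpen hopen ⟨mem_univ _, hq.2.1⟩]
  refine Eq.trans ?_ (mfderiv_prod_eq_add_apply hd).symm
  exact (zero_add _).symm.trans (congrArg₂ (fun a b : E => a + b)
    (ContinuousLinearMap.map_zero _).symm rfl)

end ChartLagrangian

/-! ### Intrinsic partial derivatives versus chart derivatives -/

section PartialDerivatives

variable {E : Type*} [NormedAddCommGroup E] [NormedSpace ℝ E]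
  {G : Type*} [TopologicalSpace G] [ChartedSpace E G] [Group G] [LieGroup 𝓘(ℝ, E) ∞ G]
  {L : TangentBundle 𝓘(ℝ, E) G × ℝ → ℝ} {g : ℝ → G} {h : ℝ}

theorem chartLagrangian_one (L : TangentBundle 𝓘(ℝ, E) G × ℝ → ℝ) (g : ℝ → G) (t : ℝ) (v : E)
    (z : ℝ) : chartLagrangian L g (t, chartOne E G 1, v, z) = trivialized L (g t) v z :=
  congrArg L (Prod.ext (mk_congr (chartTranslate_one _) (chartTangent_one _ _)) rfl)

theorem chartLagrangian_chartLeft (L : TangentBundle 𝓘(ℝ, E) G × ℝ → ℝ) (g : ℝ → G) (t : ℝ)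
    {x : E} (hx : x ∈ (chartOne E G).target) (v : E) (z : ℝ) :
    chartLagrangian L g (t, x, chartLeft E G x v, z) =
      trivialized L (chartTranslate (g t) x) v z :=
  congrArg L (Prod.ext (mk_congr rfl (chartTangent_chartLeft _ hx v)) rfl)

theorem hasFDerivAt_chartLagrangian
    (hL : ContMDiff (𝓘(ℝ, E).tangent.prod 𝓘(ℝ, ℝ)) 𝓘(ℝ, ℝ) ∞ L)
    (hg : ContMDiffOn 𝓘(ℝ, ℝ) 𝓘(ℝ, E) ∞ g (Icc 0 h)) {t : ℝ} (ht : t ∈ Icc 0 h)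
    {x : E} (hx : x ∈ (chartOne E G).target) (v : E) (z : ℝ) :
    HasFDerivAt (fun w : E × E × ℝ => chartLagrangian L g (t, w))
      (spatialFDeriv (chartLagrangian L g) t x v z) (x, v, z) :=
  (hasFDerivAt_snd_of_contDiffOn (isOpen_chartOne_target.prod isOpen_univ)
    (contDiffOn_chartLagrangian hL hg) ht ⟨hx, mem_univ _⟩).differentiableAt.hasFDerivAt

theorem derivXi_eq_momentum (hL : ContMDiff (𝓘(ℝ, E).tangent.prod 𝓘(ℝ, ℝ)) 𝓘(ℝ, ℝ) ∞ L)
    (hg : ContMDiffOn 𝓘(ℝ, ℝ) 𝓘(ℝ, E) ∞ g (Icc 0 h)) {t : ℝ} (ht : t ∈ Icc 0 h) (v : E) (z : ℝ) :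
    derivXi L (g t) v z = momentum (chartLagrangian L g) t (chartOne E G 1) v z := by
  have h1 := hasFDerivAt_chartLagrangian hL hg ht chartOne_one_mem v z
  have h2 : HasFDerivAt (fun v : E => (chartOne E G 1, v, z))
      ((ContinuousLinearMap.inr ℝ E (E × ℝ)).comp (ContinuousLinearMap.inl ℝ E ℝ)) v :=
    (hasFDerivAt_prodMk_right (𝕜 := ℝ) (chartOne E G 1) ((v, z) : E × ℝ)).comp v
      (hasFDerivAt_prodMk_left v z)
  have h3 : HasFDerivAt (fun v : E => trivialized L (g t) v z)
      (momentum (chartLagrangian L g) t (chartOne E G 1) v z) v := by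
    refine (HasFDerivAt.comp (f := fun v : E => (chartOne E G 1, v, z)) v h1
      h2).congr_of_eventuallyEq (Eventually.of_forall fun v => ?_)
    exact (chartLagrangian_one L g t v z).symm
  exact h3.fderiv

theorem derivZ_eq_dissipation (hL : ContMDiff (𝓘(ℝ, E).tangent.prod 𝓘(ℝ, ℝ)) 𝓘(ℝ, ℝ) ∞ L)
    (hg : ContMDiffOn 𝓘(ℝ, ℝ) 𝓘(ℝ, E) ∞ g (Icc 0 h)) {t : ℝ} (ht : t ∈ Icc 0 h) (v : E) (z : ℝ) :
    derivZ L (g t) v z = dissipation (chartLagrangian L g) t (chartOne E G 1) v z := by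
  have h1 := hasFDerivAt_chartLagrangian hL hg ht chartOne_one_mem v z
  have h2 : HasDerivAt (fun z : ℝ => (chartOne E G 1, v, z)) ((0 : E), (0 : E), (1 : ℝ)) z :=
    (hasDerivAt_const z _).prodMk ((hasDerivAt_const z _).prodMk (hasDerivAt_id z))
  have h3 := HasFDerivAt.comp_hasDerivAt (f := fun z : ℝ => (chartOne E G 1, v, z)) z h1 h2
  refine Eq.trans (congrArg (fun k : ℝ → ℝ => deriv k z) (funext fun z => ?_)) h3.deriv
  exact (chartLagrangian_one L g t v z).symm

theorem trivialized_mdifferentiableAt [FiniteDimensional ℝ E]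
    (hL : ContMDiff (𝓘(ℝ, E).tangent.prod 𝓘(ℝ, ℝ)) 𝓘(ℝ, ℝ) ∞ L) (a : G) (v : E) (z : ℝ) :
    MDifferentiableAt 𝓘(ℝ, E) 𝓘(ℝ, ℝ) (fun a' : G => trivialized L a' v z) a := by
  have h1 := mdifferentiableAt_mulInvariantVectorField (I := 𝓘(ℝ, E)) (G := G) v (g := a)
  exact MDifferentiableAt.comp (g := L)
    (f := fun a' : G => ((⟨a', leftTangent a' v⟩ : TangentBundle 𝓘(ℝ, E) G), z)) a
    (hL.mdifferentiable (by simp) _) (h1.prodMk mdifferentiableAt_const)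

/-- Keeping `ξ` fixed in the left trivialization means letting the chart velocity vary as `chartLeft
x v`. Hence the derivative in `x` carries a second term, the derivative of `chartLeft`. -/
theorem leftCotangent_derivG_apply [FiniteDimensional ℝ E]
    (hL : ContMDiff (𝓘(ℝ, E).tangent.prod 𝓘(ℝ, ℝ)) 𝓘(ℝ, ℝ) ∞ L)
    (hg : ContMDiffOn 𝓘(ℝ, ℝ) 𝓘(ℝ, E) ∞ g (Icc 0 h)) {t : ℝ} (ht : t ∈ Icc 0 h) (v : E) (z : ℝ)
    (η : E) :
    leftCotangent (g t) (derivG L (g t) v z) η =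
      spatialFDeriv (chartLagrangian L g) t (chartOne E G 1) v z
        (η, (fderiv ℝ (chartLeft E G) (chartOne E G 1) : E →L[ℝ] E →L[ℝ] E) η v, 0) := by
  set p := chartOne E G 1 with hp
  have hpT : p ∈ (chartOne E G).target := chartOne_one_mem
  have h1 := hasFDerivAt_chartLagrangian hL hg ht hpT v z
  have hM : HasFDerivAt (chartLeft E G) (fderiv ℝ (chartLeft E G) p) p :=
    ((contDiffOn_chartLeft.differentiableOn (by simp) p hpT).differentiableAt
      (isOpen_chartOne_target.mem_nhds hpT)).hasFDerivAt
  have hMv : HasFDerivAt (fun y => chartLeft E G y v)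
      ((fderiv ℝ (chartLeft E G) p).flip v) p := by
    simpa using hM.clm_apply (hasFDerivAt_const v p)
  have h2 : HasFDerivAt (fun y : E => (y, chartLeft E G y v, z)) _ p :=
    (hasFDerivAt_id p).prodMk (hMv.prodMk (hasFDerivAt_const z p))
  have hpv : (p, v, z) = (p, chartLeft E G p v, z) := by rw [hp, chartLeft_one]; rfl
  rw [hpv] at h1
  have h3 := HasFDerivAt.comp (f := fun y : E => (y, chartLeft E G y v, z)) p h1 h2
  have h4 := h3.congr_of_eventuallyEq
      (f₁ := (fun a => trivialized L a v z) ∘ chartTranslate (g t)) (by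
    filter_upwards [isOpen_chartOne_target.mem_nhds hpT] with y hy
    exact (chartLagrangian_chartLeft L g t hy v z).symm)
  have h5 := mfderiv_comp_apply_of_eq p (trivialized_mdifferentiableAt hL (g t) v z)
    (mdifferentiableAt_chartTranslate (g t) hpT) (chartTranslate_one (g t)) η
  rw [mfderiv_eq_fderiv, h4.fderiv] at h5
  have h6 := chartTangent_one (g t) η
  refine Eq.trans ?_ h5.symm
  exact congrArg (fun w : E => (mfderiv 𝓘(ℝ, E) 𝓘(ℝ, ℝ) (fun a => trivialized L a v z) (g t) :
    E →L[ℝ] ℝ) w) h6.symm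

/-- The chart force moves `v` by `R η v`, while `δL/δg` moves it by `M η v`. The discrepancy `R η v
- M η v` is the bracket `[v, η]`, and the momentum evaluated on it is the coadjoint term. -/
theorem force_eq [FiniteDimensional ℝ E]
    (hL : ContMDiff (𝓘(ℝ, E).tangent.prod 𝓘(ℝ, ℝ)) 𝓘(ℝ, ℝ) ∞ L)
    (hg : ContMDiffOn 𝓘(ℝ, ℝ) 𝓘(ℝ, E) ∞ g (Icc 0 h)) {t : ℝ} (ht : t ∈ Icc 0 h) (v : E) (z : ℝ) :
    coad v (derivXi L (g t) v z) + leftCotangent (g t) (derivG L (g t) v z) =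
      force (chartLagrangian L g) (fderiv ℝ (chartRight E G) (chartOne E G 1)) t
        (chartOne E G 1) v z := by
  refine ContinuousLinearMap.ext fun η : E => ?_
  set S := spatialFDeriv (chartLagrangian L g) t (chartOne E G 1) v z with hS
  set R := (fderiv ℝ (chartRight E G) (chartOne E G 1) : E →L[ℝ] E →L[ℝ] E)
  set M := (fderiv ℝ (chartLeft E G) (chartOne E G 1) : E →L[ℝ] E →L[ℝ] E)
  have h1 : coad v (derivXi L (g t) v z) η = S (0, R η v - M η v, 0) := by
    rw [derivXi_eq_momentum hL hg ht]
    exact congrArg (fun w : E => S (0, w, 0)) (bracket_eq_fderiv v η)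
  have h2 := leftCotangent_derivG_apply hL hg ht v z η
  refine (congrArg₂ (fun a b : ℝ => a + b) h1 h2).trans ?_
  rw [← hS, ← map_add]
  have h3 := spatialFDeriv_apply (chartLagrangian L g) R t (chartOne E G 1) v z η 0 0
  rw [map_zero, mul_zero, add_zero, add_zero, add_zero] at h3
  refine Eq.trans (congrArg S ?_) h3
  simp [M]

end PartialDerivatives

theorem velocity_congr {E : Type*} [NormedAddCommGroup E] [NormedSpace ℝ E]
    {G : Type*} [TopologicalSpace G] [ChartedSpace E G] {h : ℝ} {γ γ' : ℝ → G} {t : ℝ}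
    (hγ : γ =ᶠ[𝓝[Icc 0 h] t] γ') (ht : γ t = γ' t) :
    velocity (E := E) h γ t = velocity h γ' t :=
  mk_congr ht (congrArg (fun A : ℝ →L[ℝ] E => A 1) (hγ.mfderivWithin_eq ht))

/-! ### Velocities of curves and charts for variations -/

section Curves

variable {E : Type*} [NormedAddCommGroup E] [NormedSpace ℝ E]
  {G : Type*} [TopologicalSpace G] [ChartedSpace E G] [Group G] {h : ℝ} {g : ℝ → G}

/-- The left-trivialized velocity of the curve `g`, computed in the chart at the identity. -/
def bodyVelocity (E : Type*) [NormedAddCommGroup E] [NormedSpace ℝ E] {G : Type*}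
    [TopologicalSpace G] [ChartedSpace E G] [Group G] (h : ℝ) (g : ℝ → G) (t : ℝ) : E :=
  derivWithin (fun τ => chartOne E G ((g t)⁻¹ * g τ)) (Icc 0 h) t

variable [LieGroup 𝓘(ℝ, E) ∞ G]

theorem exists_isOpen_chart_domain (hg : ContMDiffOn 𝓘(ℝ, ℝ) 𝓘(ℝ, E) ∞ g (Icc 0 h)) :
    ∃ O : Set (ℝ × ℝ), IsOpen O ∧ (∀ t ∈ Icc 0 h, (t, t) ∈ O) ∧
      ContDiffOn ℝ ∞ (fun q : ℝ × ℝ => chartOne E G ((g q.1)⁻¹ * g q.2))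
        ((Icc 0 h ×ˢ Icc 0 h) ∩ O) := by
  have h1 : ContMDiffOn 𝓘(ℝ, ℝ × ℝ) 𝓘(ℝ, E) ∞ (fun q : ℝ × ℝ => (g q.1)⁻¹ * g q.2)
      (Icc 0 h ×ˢ Icc 0 h) :=
    (hg.comp contDiff_fst.contMDiff.contMDiffOn fun _ hq => hq.1).inv.mul
      (hg.comp contDiff_snd.contMDiff.contMDiffOn fun _ hq => hq.2)
  obtain ⟨O, hO, hOe⟩ := continuousOn_iff'.1 h1.continuousOn (chartOne E G).source
    (isOpen_extChartAt_source (1 : G))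
  refine ⟨O, hO, fun t ht => ?_, ?_⟩
  · have : (t, t) ∈ (fun q : ℝ × ℝ => (g q.1)⁻¹ * g q.2) ⁻¹' (chartOne E G).source ∩
        Icc 0 h ×ˢ Icc 0 h := by
      refine ⟨?_, ht, ht⟩
      simp only [mem_preimage, inv_mul_cancel]
      exact mem_extChartAt_source (1 : G)
    rw [hOe] at this
    exact this.1
  · rw [← contMDiffOn_iff_contDiffOn]
    refine contMDiffOn_chartOne.comp (h1.mono inter_subset_left) fun q hq => ?_
    have : q ∈ O ∩ Icc 0 h ×ˢ Icc 0 h := ⟨hq.2, hq.1⟩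
    rw [← hOe] at this
    exact this.1

/-- The map `(t, τ) ↦ φ(g(t)⁻¹ g(τ))` is jointly smooth near the diagonal, and the body velocity is
its `τ`-derivative restricted to the diagonal. -/
theorem contDiffOn_bodyVelocity_and_hasDerivWithinAt (hh : 0 < h)
    (hg : ContMDiffOn 𝓘(ℝ, ℝ) 𝓘(ℝ, E) ∞ g (Icc 0 h)) :
    ContDiffOn ℝ ∞ (bodyVelocity E h g) (Icc 0 h) ∧ ∀ t ∈ Icc 0 h,
      HasDerivWithinAt (fun τ => chartOne E G ((g t)⁻¹ * g τ)) (bodyVelocity E h g t)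
        (Icc 0 h) t := by
  obtain ⟨O, hO, hdiag, hk⟩ := exists_isOpen_chart_domain hg
  set S := (Icc 0 h ×ˢ Icc 0 h) ∩ O with hS
  have hSu : UniqueDiffOn ℝ S :=
    ((uniqueDiffOn_Icc hh).prod (uniqueDiffOn_Icc hh)).inter hO
  have hd : ∀ t ∈ Icc 0 h, HasDerivWithinAt (fun τ => chartOne E G ((g t)⁻¹ * g τ))
      (fderivWithin ℝ (fun q : ℝ × ℝ => chartOne E G ((g q.1)⁻¹ * g q.2)) S (t, t) (0, 1))
      (Icc 0 h) t := by
    intro t ht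
    have h1 := (hk.differentiableOn (by simp) (t, t) ⟨⟨ht, ht⟩, hdiag t ht⟩).hasFDerivWithinAt
    have h2 : HasDerivWithinAt (fun τ : ℝ => (t, τ)) ((0 : ℝ), (1 : ℝ))
        (Icc 0 h ∩ Prod.mk t ⁻¹' O) t :=
      ((hasDerivAt_const t t).prodMk (hasDerivAt_id t)).hasDerivWithinAt
    have h3 : MapsTo (fun τ : ℝ => (t, τ)) (Icc 0 h ∩ Prod.mk t ⁻¹' O) S :=
      fun τ hτ => ⟨⟨ht, hτ.1⟩, hτ.2⟩
    have h4 := h1.comp_hasDerivWithinAt t h2 h3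
    refine h4.mono_of_mem_nhdsWithin (inter_mem self_mem_nhdsWithin (mem_nhdsWithin_of_mem_nhds ?_))
    exact (Continuous.prodMk_right t).continuousAt.preimage_mem_nhds (hO.mem_nhds (hdiag t ht))
  have hb : ∀ t ∈ Icc 0 h, bodyVelocity E h g t =
      fderivWithin ℝ (fun q : ℝ × ℝ => chartOne E G ((g q.1)⁻¹ * g q.2)) S (t, t) (0, 1) :=
    fun t ht => (hd t ht).derivWithin (uniqueDiffOn_Icc hh t ht)
  refine ⟨?_, fun t ht => by rw [hb t ht]; exact hd t ht⟩
  refine ContDiffOn.congr ?_ hb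
  have h1 := hk.fderivWithin (m := ∞) hSu (by simp)
  exact (h1.comp (contDiffOn_id.prodMk contDiffOn_id)
    fun t ht => ⟨⟨ht, ht⟩, hdiag t ht⟩).clm_apply contDiffOn_const

theorem velocity_eq_of_chart (hh : 0 < h) {γ : ℝ → G} {t : ℝ} (ht : t ∈ Icc 0 h) {a : G}
    {w : ℝ → E} {w' : E} (hγ : ∀ᶠ τ in 𝓝[Icc 0 h] t, γ τ = chartTranslate a (w τ))
    (hw : HasDerivWithinAt w w' (Icc 0 h) t) (hwT : w t ∈ (chartOne E G).target) :
    velocity h γ t = ⟨chartTranslate a (w t), chartTangent a (w t) w'⟩ := by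
  rw [velocity_congr (γ' := fun τ => chartTranslate a (w τ)) hγ (hγ.self_of_nhdsWithin ht)]
  refine mk_congr rfl ?_
  have h1 := mfderiv_comp_mfderivWithin t (mdifferentiableAt_chartTranslate a hwT)
    hw.differentiableWithinAt.mdifferentiableWithinAt
    (uniqueMDiffWithinAt_iff_uniqueDiffWithinAt.2 (uniqueDiffOn_Icc hh t ht))
  refine (congrArg (fun A : ℝ →L[ℝ] E => A 1) h1).trans ?_
  have h2 : mfderivWithin 𝓘(ℝ, ℝ) 𝓘(ℝ, E) w (Icc 0 h) t (1 : ℝ) = w' := by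
    rw [mfderivWithin_eq_fderivWithin]
    exact hw.derivWithin (uniqueDiffOn_Icc hh t ht)
  exact congrArg (chartTangent a (w t)) h2

/-- The velocity of a curve `t ↦ g(t) φ⁻¹(w(t))`. -/
theorem velocity_chartTranslate (hh : 0 < h) (hg : ContMDiffOn 𝓘(ℝ, ℝ) 𝓘(ℝ, E) ∞ g (Icc 0 h))
    {γ : ℝ → G} {t : ℝ} (ht : t ∈ Icc 0 h) {w : ℝ → E} {w' : E}
    (hγ : ∀ τ ∈ Icc 0 h, γ τ = chartTranslate (g τ) (w τ))
    (hw : HasDerivWithinAt w w' (Icc 0 h) t) (hwT : w t ∈ (chartOne E G).target) :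
    velocity h γ t = ⟨chartTranslate (g t) (w t),
      chartTangent (g t) (w t) (chartRight E G (w t) (bodyVelocity E h g t) + w')⟩ := by
  -- With `t` frozen, `g(τ) φ⁻¹(w(τ)) = g(t) φ⁻¹(m(k(τ), w(τ)))` for `τ` near `t`, and `k(t) = p`.
  -- Differentiating `m` at `(p, w t)` gives `chartRight` on the first component and the identity on
  -- the second.
  set k := fun τ => chartOne E G ((g t)⁻¹ * g τ) with hk
  have hk' : HasDerivWithinAt k (bodyVelocity E h g t) (Icc 0 h) t :=
    (contDiffOn_bodyVelocity_and_hasDerivWithinAt hh hg).2 t ht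
  have hkt : k t = chartOne E G 1 := by simp [hk]
  have hkw : HasDerivWithinAt (fun τ => (k τ, w τ)) (bodyVelocity E h g t, w') (Icc 0 h) t :=
    hk'.prodMk hw
  have hdom : (k t, w t) ∈ chartMulDomain E G := by
    rw [hkt]; exact one_left_mem_chartMulDomain hwT
  have h1 : HasDerivWithinAt (fun τ => chartMul E G (k τ, w τ))
      (chartRight E G (w t) (bodyVelocity E h g t) + w') (Icc 0 h) t := by
    have h2 := HasFDerivAt.comp_hasDerivWithinAt (f := fun τ => (k τ, w τ)) t
      (hasFDerivAt_chartMul hdom) hkw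
    refine h2.congr_deriv ?_
    have h3 : ((bodyVelocity E h g t, w') : E × E) = (bodyVelocity E h g t, 0) + (0, w') := by simp
    rw [h3, map_add, hkt, fderiv_chartMul_one_left hwT]
    rfl
  have hm : chartMul E G (k t, w t) = w t := by rw [hkt]; exact chartMul_one_left hwT
  have hev : ∀ᶠ τ in 𝓝[Icc 0 h] t, γ τ = chartTranslate (g t) (chartMul E G (k τ, w τ)) := by
    have e1 : ∀ᶠ τ in 𝓝[Icc 0 h] t, (k τ, w τ) ∈ chartMulDomain E G :=
      hkw.continuousWithinAt (isOpen_chartMulDomain.mem_nhds hdom)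
    have e2 : ∀ᶠ τ in 𝓝[Icc 0 h] t, (g t)⁻¹ * g τ ∈ (chartOne E G).source := by
      have h4 : ContMDiffWithinAt 𝓘(ℝ, ℝ) 𝓘(ℝ, E) ∞ (fun τ => (g t)⁻¹ * g τ) (Icc 0 h) t :=
        contMDiffWithinAt_const.mul (hg t ht)
      refine h4.continuousWithinAt ((isOpen_extChartAt_source (1 : G)).mem_nhds ?_)
      rw [inv_mul_cancel]
      exact mem_extChartAt_source (1 : G)
    filter_upwards [e1, e2, self_mem_nhdsWithin] with τ hτ1 hτ2 hτ
    have h5 : (chartOne E G).symm (k τ) = (g t)⁻¹ * g τ := (chartOne E G).left_inv hτ2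
    have h6 := hτ1.2
    simp only [h5] at h6
    rw [hγ τ hτ]
    simp only [chartTranslate, chartMul, h5]
    rw [(chartOne E G).left_inv h6]
    group
  rw [velocity_eq_of_chart hh ht hev h1 (by rw [hm]; exact hwT), hm]

theorem velocity_eq_bodyVelocity (hh : 0 < h)
    (hg : ContMDiffOn 𝓘(ℝ, ℝ) 𝓘(ℝ, E) ∞ g (Icc 0 h)) {t : ℝ} (ht : t ∈ Icc 0 h) :
    velocity h g t = ⟨g t, leftTangent (g t) (bodyVelocity E h g t)⟩ := by
  rw [velocity_chartTranslate (w := fun _ => chartOne E G 1) (w' := 0) hh hg ht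
    (fun τ _ => (chartTranslate_one (g τ)).symm) (hasDerivWithinAt_const _ _ _) chartOne_one_mem]
  refine mk_congr (chartTranslate_one _) ?_
  rw [chartRight_one, add_zero]
  exact chartTangent_one _ _

/-- A variation of `g` reads `c(t, s) = g(t) φ⁻¹(u(t, s))` for small `s`. -/
theorem IsVariation.exists_chart {c : ℝ → ℝ → G}
    (hg : ContMDiffOn 𝓘(ℝ, ℝ) 𝓘(ℝ, E) ∞ g (Icc 0 h))
    (hc : IsVariation (E := E) h g c) :
    ∃ δ > 0, ContDiffOn ℝ ∞ (fun q : ℝ × ℝ => chartOne E G ((g q.1)⁻¹ * c q.1 q.2))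
        (Icc 0 h ×ˢ Ioo (-δ) δ) ∧
      ∀ t ∈ Icc 0 h, ∀ s ∈ Ioo (-δ) δ, (g t)⁻¹ * c t s ∈ (chartOne E G).source := by
  obtain ⟨ε, hε, hsm⟩ := hc.smooth
  have h1 : ContMDiffOn 𝓘(ℝ, ℝ × ℝ) 𝓘(ℝ, E) ∞ (fun q : ℝ × ℝ => (g q.1)⁻¹ * c q.1 q.2)
      (Icc 0 h ×ˢ Ioo (-ε) ε) :=
    (hg.comp contDiff_fst.contMDiff.contMDiffOn fun _ hq => hq.1).inv.mul hsm
  have h0 : (0 : ℝ) ∈ Ioo (-ε) ε := ⟨by simpa using hε, hε⟩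
  -- Since `g(t)⁻¹ c(t, 0) = 1` for every `t`, compactness of `[0, h]` gives one range of `s` that
  -- works for all times.
  have key : ∀ᶠ s in 𝓝 (0 : ℝ), ∀ t ∈ Icc 0 h, t ∈ Icc 0 h → s ∈ Ioo (-ε) ε →
      (g t)⁻¹ * c t s ∈ (chartOne E G).source := by
    refine isCompact_Icc.eventually_forall_of_forall_eventually fun t ht => ?_
    have h2 : ∀ᶠ q in 𝓝[Icc 0 h ×ˢ Ioo (-ε) ε] (t, (0 : ℝ)),
        (g q.1)⁻¹ * c q.1 q.2 ∈ (chartOne E G).source := by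
      refine h1.continuousOn (t, 0) ⟨ht, h0⟩ ((isOpen_extChartAt_source (1 : G)).mem_nhds ?_)
      simp only [hc.base t ht, inv_mul_cancel]
      exact mem_extChartAt_source (1 : G)
    rw [eventually_nhdsWithin_iff] at h2
    have h3 : Tendsto (Prod.swap : ℝ × ℝ → ℝ × ℝ) (𝓝 (0, t)) (𝓝 (t, 0)) :=
      continuous_swap.tendsto _
    filter_upwards [h3.eventually h2] with q hq h4 h5 using hq ⟨h4, h5⟩
  obtain ⟨δ, hδ, hball⟩ := Metric.eventually_nhds_iff.1 key
  refine ⟨min δ ε, lt_min hδ hε, ?_, ?_⟩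
  · have hsub : Ioo (-(min δ ε)) (min δ ε) ⊆ Ioo (-ε) ε :=
      Ioo_subset_Ioo (neg_le_neg (min_le_right _ _)) (min_le_right _ _)
    rw [← contMDiffOn_iff_contDiffOn]
    refine contMDiffOn_chartOne.comp (h1.mono (prod_mono_right hsub)) fun q hq => ?_
    refine hball ?_ q.1 hq.1 hq.1 (hsub hq.2)
    rw [Real.dist_eq, sub_zero]
    exact (abs_lt.2 hq.2).trans_le (min_le_left _ _)
  · intro t ht s hs
    refine hball ?_ t ht ht ⟨?_, ?_⟩
    · rw [Real.dist_eq, sub_zero]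
      exact (abs_lt.2 hs).trans_le (min_le_left _ _)
    · exact (neg_le_neg (min_le_right _ _)).trans_lt hs.1
    · exact hs.2.trans_le (min_le_right _ _)

end Curves

/-! ### First variation of the Herglotz action on the group -/

section FirstVariation

variable {E : Type*} [NormedAddCommGroup E] [NormedSpace ℝ E]
  {G : Type*} [TopologicalSpace G] [ChartedSpace E G] [Group G] [LieGroup 𝓘(ℝ, E) ∞ G]
  {L : TangentBundle 𝓘(ℝ, E) G × ℝ → ℝ} {h : ℝ} {g : ℝ → G} {z : ℝ → ℝ} {c : ℝ → ℝ → G}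

theorem lagrangian_velocity_eq (hh : 0 < h) (hg : ContMDiffOn 𝓘(ℝ, ℝ) 𝓘(ℝ, E) ∞ g (Icc 0 h))
    {t : ℝ} (ht : t ∈ Icc 0 h) (x : ℝ) :
    L (velocity h g t, x) =
      chartLagrangian L g (t, chartOne E G 1, bodyVelocity E h g t, x) := by
  rw [velocity_eq_bodyVelocity hh hg ht, chartLagrangian_one]
  rfl

/-- The coordinates `u(t, s) = φ(g(t)⁻¹ c(t, s))` of a variation `c` of `g`. -/
def chartVariation (E : Type*) [NormedAddCommGroup E] [NormedSpace ℝ E] {G : Type*}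
    [TopologicalSpace G] [ChartedSpace E G] [Group G] (g : ℝ → G) (c : ℝ → ℝ → G)
    (q : ℝ × ℝ) : E :=
  chartOne E G ((g q.1)⁻¹ * c q.1 q.2)

theorem lagrangian_variation_eq (hh : 0 < h) (hg : ContMDiffOn 𝓘(ℝ, ℝ) 𝓘(ℝ, E) ∞ g (Icc 0 h))
    {δ : ℝ} (hu : ContDiffOn ℝ ∞ (chartVariation E g c) (Icc 0 h ×ˢ Ioo (-δ) δ))
    (hcs : ∀ t ∈ Icc 0 h, ∀ s ∈ Ioo (-δ) δ, (g t)⁻¹ * c t s ∈ (chartOne E G).source)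
    {t : ℝ} (ht : t ∈ Icc 0 h) {s : ℝ} (hs : s ∈ Ioo (-δ) δ) (x : ℝ) :
    L (velocity h (fun t => c t s) t, x) =
      variedLagrangian h (chartLagrangian L g) (chartRight E G) (bodyVelocity E h g)
        (chartVariation E g c) (t, s, x) := by
  have h1 : ∀ τ ∈ Icc 0 h, c τ s = chartTranslate (g τ) (chartVariation E g c (τ, s)) := by
    intro τ hτ
    simp only [chartTranslate, chartVariation]
    rw [(chartOne E G).left_inv (hcs τ hτ s hs), mul_inv_cancel_left]
  have h2 := (hasDerivWithinAt_fst_of_contDiffOn hu ht hs).differentiableWithinAt.hasDerivWithinAt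
  rw [velocity_chartTranslate hh hg ht h1 h2 ((chartOne E G).map_source (hcs t ht s hs))]
  rfl

/-- The solutions of the Herglotz equation persist along a variation. -/
theorem IsVariation.exists_solution (hh : 0 < h)
    (hL : ContMDiff (𝓘(ℝ, E).tangent.prod 𝓘(ℝ, ℝ)) 𝓘(ℝ, ℝ) ∞ L)
    (hg : ContMDiffOn 𝓘(ℝ, ℝ) 𝓘(ℝ, E) ∞ g (Icc 0 h)) (hz : SolvesHerglotzODE L h (z 0) g z)
    (hc : IsVariation (E := E) h g c) :
    ∃ Z : ℝ → ℝ → ℝ, ∀ᶠ s in 𝓝 (0 : ℝ), SolvesHerglotzODE L h (z 0) (fun t => c t s) (Z s) := by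
  obtain ⟨δ, hδ, hu, hcs⟩ := hc.exists_chart hg
  have hΛ := contDiffOn_variedLagrangian hh (contDiffOn_chartLagrangian hL hg)
    (contDiffOn_chartRight (E := E) (G := G))
    (contDiffOn_bodyVelocity_and_hasDerivWithinAt hh hg).1 hu
    fun q hq => (chartOne E G).map_source (hcs q.1 hq.1 q.2 hq.2)
  have hV : IsOpen (Ioo (-δ) δ ×ˢ (univ : Set ℝ)) := isOpen_Ioo.prod isOpen_univ
  have h0 : (0 : ℝ) ∈ Ioo (-δ) δ := ⟨by simpa using hδ, hδ⟩
  obtain ⟨C, hC⟩ := eventually_exists_solution (z := z)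
    (f := fun t w => variedLagrangian h (chartLagrangian L g) (chartRight E G)
      (bodyVelocity E h g) (chartVariation E g c) (t, w)) hh hδ hΛ.continuousOn
    (fun t ht w hw =>
      (hasFDerivAt_snd_of_contDiffOn hV hΛ ht hw).differentiableAt.hasFDerivAt)
    (contDiffOn_fderiv_snd hh hV hΛ).continuousOn (fun t ht => by
      have h1 := lagrangian_variation_eq (L := L) hh hg hu hcs ht h0 (z t)
      have h2 : velocity (E := E) h (fun t => c t 0) t = velocity h g t :=
        velocity_congr (eventually_nhdsWithin_of_forall hc.base) (hc.base t ht)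
      rw [h2] at h1
      exact h1 ▸ hz.2 t ht)
  have hC' := hC.and (Ioo_mem_nhds h0.1 h0.2)
  choose! Z hZ using fun s (hs : s ∈ {s | (∃ Y : ℝ → ℝ, Y 0 = z 0 ∧
      (∀ t ∈ Icc 0 h, HasDerivWithinAt Y (variedLagrangian h (chartLagrangian L g)
        (chartRight E G) (bodyVelocity E h g) (chartVariation E g c) (t, s, Y t)) (Icc 0 h) t) ∧
      ∀ t ∈ Icc 0 h, |Y t - z t| ≤ C * |s|) ∧ s ∈ Ioo (-δ) δ}) => hs.1
  refine ⟨Z, hC'.mono fun s hs => ⟨(hZ s hs).1, fun t ht => ?_⟩⟩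
  rw [lagrangian_variation_eq (L := L) hh hg hu hcs ht hs.2]
  exact (hZ s hs).2.1 t ht

/-- The defect of the Herglotz equation along `g`. -/
def groupDefect (L : TangentBundle 𝓘(ℝ, E) G × ℝ → ℝ) (h : ℝ) (g : ℝ → G) (z : ℝ → ℝ) (t : ℝ) :
    E →L[ℝ] ℝ :=
  defect h (chartLagrangian L g) (fderiv ℝ (chartRight E G) (chartOne E G 1)) (chartOne E G 1)
    (bodyVelocity E h g) z t

/-- The accumulated dissipation along `g`. -/
def totalDissipation (L : TangentBundle 𝓘(ℝ, E) G × ℝ → ℝ) (h : ℝ) (g : ℝ → G) (z : ℝ → ℝ)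
    (t : ℝ) : ℝ :=
  ∫ τ in (0 : ℝ)..t, dissipation (chartLagrangian L g) τ (chartOne E G 1)
    (bodyVelocity E h g τ) (z τ)

/-- First variation of the Herglotz action. -/
theorem IsVariation.hasDerivAt_action (hh : 0 < h)
    (hL : ContMDiff (𝓘(ℝ, E).tangent.prod 𝓘(ℝ, ℝ)) 𝓘(ℝ, ℝ) ∞ L)
    (hg : ContMDiffOn 𝓘(ℝ, ℝ) 𝓘(ℝ, E) ∞ g (Icc 0 h)) (hz : SolvesHerglotzODE L h (z 0) g z)
    (hc : IsVariation (E := E) h g c) {Z : ℝ → ℝ → ℝ}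
    (hZ : ∀ᶠ s in 𝓝 (0 : ℝ), SolvesHerglotzODE L h (z 0) (fun t => c t s) (Z s)) :
    HasDerivAt (fun s => action L h (fun t => c t s) (Z s))
      (-(Real.exp (totalDissipation L h g z h) *
        ∫ σ in (0 : ℝ)..h, Real.exp (-totalDissipation L h g z σ) *
          groupDefect L h g z σ (deriv (fun s => chartVariation E g c (σ, s)) 0))) 0 := by
  obtain ⟨δ, hδ, hu, hcs⟩ := hc.exists_chart hg
  have hℓ := contDiffOn_chartLagrangian hL hg
  have hξ := (contDiffOn_bodyVelocity_and_hasDerivWithinAt hh hg).1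
  have hmaps : MapsTo (chartVariation E g c) (Icc 0 h ×ˢ Ioo (-δ) δ) (chartOne E G).target :=
    fun q hq => (chartOne E G).map_source (hcs q.1 hq.1 q.2 hq.2)
  have hΛ := contDiffOn_variedLagrangian hh hℓ (contDiffOn_chartRight (E := E) (G := G)) hξ hu hmaps
  have h0 : (0 : ℝ) ∈ Ioo (-δ) δ := ⟨by simpa using hδ, hδ⟩
  have hend : ∀ t : ℝ, (∀ᶠ s in 𝓝 (0 : ℝ), c t s = g t) →
      ∀ᶠ s in 𝓝 (0 : ℝ), chartVariation E g c (t, s) = chartOne E G 1 := fun t ht =>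
    ht.mono fun s hs => by simp [chartVariation, hs]
  have key := hasDerivAt_final_value_variation (Z := Z) (z := z) hh hδ isOpen_chartOne_target hℓ
    (contDiffOn_chartRight (E := E) (G := G)) hξ chartOne_one_mem chartRight_one hu hmaps
    (fun t ht => by simp [hc.base t ht]) (hend 0 hc.left) (hend h hc.right)
    (fun t ht => by
      rw [← lagrangian_velocity_eq hh hg ht]
      exact hz.2 t ht) (by
    filter_upwards [hZ, Ioo_mem_nhds h0.1 h0.2] with s hs hsδ
    refine ⟨hs.1, fun t ht => ?_⟩
    have h1 := lagrangian_variation_eq (L := L) hh hg hu hcs ht hsδ (Z s t)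
    rw [variedLagrangian] at h1 ⊢
    exact h1 ▸ hs.2 t ht)
  -- The integrand of the action is the time derivative of `Z s`, so the action equals `Z s h - z 0`
  -- for small `s`.
  refine (key.sub_const (z 0)).congr_of_eventuallyEq ?_
  filter_upwards [hZ, Ioo_mem_nhds h0.1 h0.2] with s hs hsδ
  have hZc : ContinuousOn (Z s) (Icc 0 h) := fun t ht => (hs.2 t ht).continuousWithinAt
  have hcont : ContinuousOn (fun t => L (velocity h (fun t => c t s) t, Z s t)) (Icc 0 h) := by
    have h1 : ContinuousOn (fun t => variedLagrangian h (chartLagrangian L g) (chartRight E G)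
        (bodyVelocity E h g) (chartVariation E g c) (t, s, Z s t)) (Icc 0 h) :=
      hΛ.continuousOn.comp (continuousOn_id.prodMk (continuousOn_const.prodMk hZc))
        fun t ht => ⟨ht, hsδ, mem_univ _⟩
    exact h1.congr fun t ht => lagrangian_variation_eq hh hg hu hcs ht hsδ _
  rw [action, intervalIntegral.integral_eq_sub_of_hasDeriv_right_of_le hh.le hZc
    (fun t ht => ((hs.2 t (Ioo_subset_Icc_self ht)).hasDerivAt
      (Icc_mem_nhds ht.1 ht.2)).hasDerivWithinAt)
    (ContinuousOn.intervalIntegrable (by rwa [uIcc_of_le hh.le])), hs.1]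

/-- The momentum is differentiable in time in any case, so the Herglotz equation only fixes the
value of its derivative. The identifications of `derivXi`, `derivZ` and the force with their chart
versions turn that into the vanishing of the defect. -/
theorem herglotz_iff_groupDefect_eq_zero [FiniteDimensional ℝ E] (hh : 0 < h)
    (hL : ContMDiff (𝓘(ℝ, E).tangent.prod 𝓘(ℝ, ℝ)) 𝓘(ℝ, ℝ) ∞ L)
    (hg : ContMDiffOn 𝓘(ℝ, ℝ) 𝓘(ℝ, E) ∞ g (Icc 0 h)) (hz : SolvesHerglotzODE L h (z 0) g z)
    {ξ : ℝ → GroupLieAlgebra 𝓘(ℝ, E) G} (hξ : ∀ t ∈ Icc 0 h, ξ t = bodyVelocity E h g t)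
    {t : ℝ} (ht : t ∈ Icc 0 h) :
    HasDerivWithinAt (fun t' => derivXi L (g t') (ξ t') (z t'))
        (coad (ξ t) (derivXi L (g t) (ξ t) (z t)) +
          leftCotangent (g t) (derivG L (g t) (ξ t) (z t)) +
          derivZ L (g t) (ξ t) (z t) • derivXi L (g t) (ξ t) (z t)) (Icc 0 h) t ↔
      groupDefect L h g z t = 0 := by
  set μ : ℝ → E →L[ℝ] ℝ := fun t => momentum (chartLagrangian L g) t (chartOne E G 1)
    (bodyVelocity E h g t) (z t) with hμ
  have hμd : ContDiffOn ℝ 1 μ (Icc 0 h) := contDiffOn_momentum hh isOpen_chartOne_target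
    chartOne_one_mem (contDiffOn_chartLagrangian hL hg)
    (contDiffOn_bodyVelocity_and_hasDerivWithinAt hh hg).1
    fun t ht => by
      rw [← lagrangian_velocity_eq hh hg ht]
      exact hz.2 t ht
  have hμ' : ∀ t ∈ Icc 0 h, derivXi L (g t) (ξ t) (z t) = μ t := fun t ht => by
    rw [hξ t ht]
    exact derivXi_eq_momentum hL hg ht _ _
  set F : E →L[ℝ] ℝ := force (chartLagrangian L g) (fderiv ℝ (chartRight E G) (chartOne E G 1)) t
        (chartOne E G 1) (bodyVelocity E h g t) (z t) +
      dissipation (chartLagrangian L g) t (chartOne E G 1) (bodyVelocity E h g t) (z t) • μ t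
      with hF
  have hR : coad (ξ t) (derivXi L (g t) (ξ t) (z t)) +
      leftCotangent (g t) (derivG L (g t) (ξ t) (z t)) +
      derivZ L (g t) (ξ t) (z t) • derivXi L (g t) (ξ t) (z t) = F := by
    have h1 := hμ' t ht
    rw [hξ t ht] at h1 ⊢
    rw [force_eq hL hg ht, derivZ_eq_dissipation hL hg ht, h1]
    rfl
  have hdef : groupDefect L h g z t = derivWithin μ (Icc 0 h) t - F := by
    rw [hF, ← sub_sub]
    rfl
  rw [hR, hdef, sub_eq_zero]
  have hcongr : HasDerivWithinAt (fun t' => derivXi L (g t') (ξ t') (z t')) F (Icc 0 h) t ↔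
      HasDerivWithinAt μ F (Icc 0 h) t :=
    ⟨fun H => H.congr_of_mem (fun t ht => (hμ' t ht).symm) ht,
      fun H => HasDerivWithinAt.congr_of_mem (F := E →L[ℝ] ℝ) H hμ' ht⟩
  rw [hcongr]
  refine ⟨fun H => H.derivWithin (uniqueDiffOn_Icc hh t ht), fun H => ?_⟩
  rw [← H]
  exact (hμd.differentiableOn one_ne_zero t ht).hasDerivWithinAt

end FirstVariation

/-! ### Fundamental lemma and bump variations -/

section FundamentalLemma

variable {E : Type*} [NormedAddCommGroup E] [NormedSpace ℝ E]

/-- Fundamental lemma of the calculus of variations on an interval. -/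
theorem eqOn_zero_of_forall_bump {h : ℝ} (hh : 0 < h) {F : ℝ → ℝ} (hF : ContinuousOn F (Icc 0 h))
    (H : ∀ a : ℝ → ℝ, ContDiff ℝ ∞ a → HasCompactSupport a → tsupport a ⊆ Ioo 0 h →
      ∫ t in (0 : ℝ)..h, a t * F t = 0) : ∀ t ∈ Icc 0 h, F t = 0 := by
  have hloc : MeasureTheory.LocallyIntegrableOn F (Ioo 0 h) :=
    (hF.mono Ioo_subset_Icc_self).locallyIntegrableOn measurableSet_Ioo
  have hae := isOpen_Ioo.ae_eq_zero_of_integral_contDiff_smul_eq_zero hloc fun a ha hac has => by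
    rw [← H a ha hac has, intervalIntegral.integral_of_le hh.le,
      MeasureTheory.integral_Ioc_eq_integral_Ioo]
    refine (MeasureTheory.setIntegral_eq_integral_of_forall_compl_eq_zero fun t ht => ?_).symm
    have : a t = 0 := image_eq_zero_of_notMem_tsupport fun h' => ht (has h')
    rw [this, zero_smul]
  have h1 : F =ᵐ[MeasureTheory.volume.restrict (Icc 0 h)] fun _ => 0 := by
    rw [← MeasureTheory.restrict_Ioo_eq_restrict_Icc]
    exact (MeasureTheory.ae_restrict_iff' measurableSet_Ioo).2 hae
  exact MeasureTheory.Measure.eqOn_Icc_of_ae_eq _ hh.ne h1 hF continuousOn_const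

variable {G : Type*} [TopologicalSpace G] [ChartedSpace E G] [Group G]

/-- The variation of `g` obtained by moving in the chart along `a(t) v`. -/
def bumpVariation (g : ℝ → G) (a : ℝ → ℝ) (v : E) (t s : ℝ) : G :=
  chartTranslate (g t) (chartOne E G 1 + (s * a t) • v)

theorem eventually_bump_mem (a : ℝ → ℝ) {C : ℝ} (hC : ∀ t, ‖a t‖ ≤ C) (v : E) :
    ∃ ε > 0, ∀ s ∈ Ioo (-ε) ε, ∀ t, chartOne E G 1 + (s * a t) • v ∈ (chartOne E G).target := by
  obtain ⟨r, hr, hball⟩ := Metric.isOpen_iff.1 (isOpen_chartOne_target (E := E) (G := G)) _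
    chartOne_one_mem
  have hC0 : 0 ≤ C := (norm_nonneg _).trans (hC 0)
  refine ⟨r / (C * ‖v‖ + 1), by positivity, fun s hs t => hball ?_⟩
  have hs' : |s| < r / (C * ‖v‖ + 1) := abs_lt.2 hs
  rw [Metric.mem_ball, dist_eq_norm, add_sub_cancel_left, norm_smul, norm_mul, Real.norm_eq_abs s]
  rw [lt_div_iff₀ (by positivity)] at hs'
  calc |s| * ‖a t‖ * ‖v‖ ≤ |s| * C * ‖v‖ := by gcongr; exact hC t
    _ ≤ |s| * (C * ‖v‖ + 1) := by nlinarith [abs_nonneg s]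
    _ < r := hs'

theorem deriv_chartVariation_bumpVariation (g : ℝ → G) {a : ℝ → ℝ} {C : ℝ} (hC : ∀ t, ‖a t‖ ≤ C)
    (v : E) (t : ℝ) :
    deriv (fun s => chartVariation E g (bumpVariation g a v) (t, s)) 0 = a t • v := by
  obtain ⟨ε, hε, hmem⟩ := eventually_bump_mem (G := G) a hC v
  have h1 : (fun s => chartVariation E g (bumpVariation g a v) (t, s)) =ᶠ[𝓝 0]
      fun s => chartOne E G 1 + (s * a t) • v := by
    filter_upwards [Ioo_mem_nhds (show -ε < 0 by simpa using hε) hε] with s hs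
    simp only [chartVariation, bumpVariation, chartTranslate, inv_mul_cancel_left]
    exact (chartOne E G).right_inv (hmem s hs t)
  rw [h1.deriv_eq]
  have h2 : HasDerivAt (fun s : ℝ => chartOne E G 1 + (s * a t) • v) ((1 * a t) • v) 0 :=
    (((hasDerivAt_id (0 : ℝ)).mul_const (a t)).smul_const v).const_add _
  rw [h2.deriv, one_mul]

variable [LieGroup 𝓘(ℝ, E) ∞ G] {h : ℝ} {g : ℝ → G}

theorem isVariation_bumpVariation (hg : ContMDiffOn 𝓘(ℝ, ℝ) 𝓘(ℝ, E) ∞ g (Icc 0 h))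
    {a : ℝ → ℝ} (ha : ContDiff ℝ ∞ a) {C : ℝ} (hC : ∀ t, ‖a t‖ ≤ C) (h0 : a 0 = 0) (h1 : a h = 0)
    (v : E) : IsVariation (E := E) h g (bumpVariation g a v) := by
  refine ⟨?_, fun t _ => ?_, Eventually.of_forall fun s => ?_, Eventually.of_forall fun s => ?_⟩
  · obtain ⟨ε, hε, hmem⟩ := eventually_bump_mem (G := G) a hC v
    refine ⟨ε, hε, ?_⟩
    have h2 : ContDiff ℝ ∞ fun q : ℝ × ℝ => chartOne E G 1 + (q.2 * a q.1) • v :=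
      contDiff_const.add ((contDiff_snd.mul (ha.comp contDiff_fst)).smul contDiff_const)
    exact (hg.comp contDiff_fst.contMDiff.contMDiffOn fun _ hq => hq.1).mul
      (contMDiffOn_chartOne_symm.comp h2.contMDiff.contMDiffOn fun q hq => hmem q.2 hq.2 q.1)
  · rw [bumpVariation, zero_mul, zero_smul, add_zero, chartTranslate_one]
  · rw [bumpVariation, h0, mul_zero, zero_smul, add_zero, chartTranslate_one]
  · rw [bumpVariation, h1, mul_zero, zero_smul, add_zero, chartTranslate_one]

variable {L : TangentBundle 𝓘(ℝ, E) G × ℝ → ℝ} {z : ℝ → ℝ}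

/-- In the first variation formula the defect is weighted by a positive exponential. Bump
variations, with `η = a(t) v`, test it in every direction `v` at every interior time, and continuity
covers the endpoints. -/
theorem isCritical_iff_groupDefect_eq_zero (hh : 0 < h)
    (hL : ContMDiff (𝓘(ℝ, E).tangent.prod 𝓘(ℝ, ℝ)) 𝓘(ℝ, ℝ) ∞ L)
    (hg : ContMDiffOn 𝓘(ℝ, ℝ) 𝓘(ℝ, E) ∞ g (Icc 0 h)) (hz : SolvesHerglotzODE L h (z 0) g z) :
    IsCritical L h (z 0) g ↔ ∀ t ∈ Icc 0 h, groupDefect L h g z t = 0 := by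
  constructor
  · intro hcrit
    have hℓ := contDiffOn_chartLagrangian hL hg
    have hξ := (contDiffOn_bodyVelocity_and_hasDerivWithinAt hh hg).1
    have hz' : ∀ t ∈ Icc 0 h, HasDerivWithinAt z (chartLagrangian L g
        (t, chartOne E G 1, bodyVelocity E h g t, z t)) (Icc 0 h) t := fun t ht => by
      rw [← lagrangian_velocity_eq hh hg ht]
      exact hz.2 t ht
    have hzc : ContinuousOn z (Icc 0 h) := fun t ht => (hz' t ht).continuousWithinAt
    have hdefc : ContinuousOn (groupDefect L h g z) (Icc 0 h) :=
      continuousOn_defect hh isOpen_chartOne_target chartOne_one_mem hℓ hξ _ hz'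
    have hdisc := continuousOn_dissipation hh isOpen_chartOne_target chartOne_one_mem hℓ hξ hzc
    have htot : ContinuousOn (totalDissipation L h g z) (Icc 0 h) := by
      have h1 := intervalIntegral.continuousOn_primitive_interval (μ := MeasureTheory.volume)
        (a := 0) (b := h) (by
          rw [uIcc_of_le hh.le]
          exact hdisc.integrableOn_compact isCompact_Icc)
      rwa [uIcc_of_le hh.le] at h1
    have hexp : ContinuousOn (fun t => Real.exp (-totalDissipation L h g z t)) (Icc 0 h) :=
      Real.continuous_exp.comp_continuousOn htot.neg
    have key : ∀ v : E, ∀ t ∈ Icc 0 h,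
        Real.exp (-totalDissipation L h g z t) * groupDefect L h g z t v = 0 := by
      intro v
      refine eqOn_zero_of_forall_bump hh
        (hexp.mul (hdefc.clm_apply continuousOn_const)) fun a ha hac has => ?_
      obtain ⟨C, hC⟩ := hac.exists_bound_of_continuous ha.continuous
      have hvar := isVariation_bumpVariation (v := v) hg ha hC
        (image_eq_zero_of_notMem_tsupport fun h' => (has h').1.false)
        (image_eq_zero_of_notMem_tsupport fun h' => (has h').2.false)
      -- Criticality speaks only about given families of solutions; without existence it would say
      -- nothing about this variation.
      obtain ⟨Z, hZ⟩ := hvar.exists_solution hh hL hg hz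
      have h1 := (hvar.hasDerivAt_action hh hL hg hz hZ).unique (hcrit _ hvar Z hZ)
      have h2 := (mul_eq_zero.1 (neg_eq_zero.1 h1)).resolve_left (Real.exp_pos _).ne'
      refine (intervalIntegral.integral_congr fun t _ => ?_).trans h2
      simp only [deriv_chartVariation_bumpVariation (E := E) g hC v t, map_smul, smul_eq_mul]
      ring
    intro t ht
    ext v
    exact (mul_eq_zero.1 (key v t ht)).resolve_left (Real.exp_pos _).ne'
  · intro hdef c hc Z hZ
    refine (hc.hasDerivAt_action hh hL hg hz hZ).congr_deriv ?_
    have h1 : ∫ σ in (0 : ℝ)..h, Real.exp (-totalDissipation L h g z σ) *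
        groupDefect L h g z σ (deriv (fun s => chartVariation E g c (σ, s)) 0) = 0 := by
      refine (intervalIntegral.integral_congr (g := fun _ => 0) fun t ht => ?_).trans
        intervalIntegral.integral_zero
      rw [uIcc_of_le hh.le] at ht
      simp [hdef t ht]
    rw [h1, mul_zero, neg_zero]

end FundamentalLemma

end Herglotz

end

/-! ### The equivalence -/

theorem mainTheorem2 {E : Type*} [NormedAddCommGroup E] [NormedSpace ℝ E] [FiniteDimensional ℝ E]
    {G : Type*} [TopologicalSpace G] [ChartedSpace E G] [Group G] [LieGroup 𝓘(ℝ, E) ∞ G]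
    (L : TangentBundle 𝓘(ℝ, E) G × ℝ → ℝ)
    (hL : ContMDiff (𝓘(ℝ, E).tangent.prod 𝓘(ℝ, ℝ)) 𝓘(ℝ, ℝ) ∞ L)
    (h : ℝ) (hh : 0 < h)
    (g : ℝ → G) (hg : ContMDiffOn 𝓘(ℝ, ℝ) 𝓘(ℝ, E) ∞ g (Icc 0 h))
    (ξ : ℝ → GroupLieAlgebra 𝓘(ℝ, E) G) (z : ℝ → ℝ) :
    ((∀ t ∈ Icc (0 : ℝ) h, ξ t = Herglotz.leftTrivialize (Herglotz.velocity h g t)) ∧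
      Herglotz.SolvesHerglotzODE L h (z 0) g z ∧
      Herglotz.IsCritical L h (z 0) g) ↔
    ∀ t ∈ Icc (0 : ℝ) h,
      HasDerivWithinAt (fun t' => Herglotz.derivXi L (g t') (ξ t') (z t'))
        (Herglotz.coad (ξ t) (Herglotz.derivXi L (g t) (ξ t) (z t)) +
          Herglotz.leftCotangent (g t) (Herglotz.derivG L (g t) (ξ t) (z t)) +
          Herglotz.derivZ L (g t) (ξ t) (z t) • Herglotz.derivXi L (g t) (ξ t) (z t))
        (Icc 0 h) t ∧
      Herglotz.velocity h g t = ⟨g t, Herglotz.leftTangent (g t) (ξ t)⟩ ∧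
      HasDerivWithinAt z (Herglotz.trivialized L (g t) (ξ t) (z t)) (Icc 0 h) t := by
  have hvel : ∀ t ∈ Icc 0 h, Herglotz.leftTrivialize (E := E) (Herglotz.velocity h g t) =
      Herglotz.bodyVelocity E h g t := fun t ht => by
    rw [Herglotz.velocity_eq_bodyVelocity hh hg ht]
    exact Herglotz.leftTrivialize_leftTangent _ _
  constructor
  · rintro ⟨hξ, hz, hcrit⟩ t ht
    have hξ' : ∀ t ∈ Icc 0 h, ξ t = Herglotz.bodyVelocity E h g t := fun t ht =>
      (hξ t ht).trans (hvel t ht)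
    have hv : Herglotz.velocity (E := E) h g t = ⟨g t, Herglotz.leftTangent (g t) (ξ t)⟩ := by
      rw [hξ' t ht]
      exact Herglotz.velocity_eq_bodyVelocity hh hg ht
    refine ⟨(Herglotz.herglotz_iff_groupDefect_eq_zero hh hL hg hz hξ' ht).2
      ((Herglotz.isCritical_iff_groupDefect_eq_zero hh hL hg hz).1 hcrit t ht), hv, ?_⟩
    rw [Herglotz.trivialized, ← hv]
    exact hz.2 t ht
  · intro H
    have hξ : ∀ t ∈ Icc 0 h, ξ t = Herglotz.leftTrivialize (E := E) (Herglotz.velocity h g t) :=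
      fun t ht => by
        rw [(H t ht).2.1]
        exact (Herglotz.leftTrivialize_leftTangent _ _).symm
    have hz : Herglotz.SolvesHerglotzODE L h (z 0) g z := ⟨rfl, fun t ht => by
      rw [(H t ht).2.1]
      exact (H t ht).2.2⟩
    have hξ' : ∀ t ∈ Icc 0 h, ξ t = Herglotz.bodyVelocity E h g t := fun t ht =>
      (hξ t ht).trans (hvel t ht)
    exact ⟨hξ, hz, (Herglotz.isCritical_iff_groupDefect_eq_zero hh hL hg hz).2 fun t ht =>
      (Herglotz.herglotz_iff_groupDefect_eq_zero hh hL hg hz hξ' ht).1 (H t ht).1⟩
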